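/- Let $\ell^2=\ell^2(\mathbb N)$ be the complex Hilbert space of square-summable sequences (inner products are linear in the second variable). Let $\mathcal U_1(\ell^2)$ be the group of all unitary operators $u$ on $\ell^2$ such that $u-1$ is of trace class, equipped with the topology of the metric $d(u,v)=\|u-v\|_1=\operatorname{Tr}|u-v|$. For $p\ge 0$ let $A_p=\frac1{p!}\sum_{\sigma\in S_p}\operatorname{sgn}(\sigma)U(\sigma)$ be the antisymmetrizer on the Hilbert space tensor power $\otimes^p\ell^2$, where $U(\sigma)(\xi_1\otimes\cdots\otimes\xi_p)=\xi_{\sigma(1)}\otimes\cdots\otimes\xi_{\sigma(p)}$, let $\wedge^p\ell^2=A_p(\otimes^p\ell^2)$ (so $\wedge^0\ell^2=\mathbb C$), and let $\mathscr F=\bigoplus_{p\ge0}\wedge^p\ell^2$ be the Fermion Fock space. For $\xi\in\ell^2$ the creation operator $a^\dagger(\xi)$ is the bounded operator on $\mathscr F$ with $a^\dagger(\xi)\psi=\sqrt{p+1}\,A_{p+1}(\xi\otimes\psi)$ for $\psi\in\wedge^p\ell^2$, and $a(\xi)=a^\dagger(\xi)^*$. Let $\mathrm{CAR}(\ell^2)$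 be the $C^*$-algebra of operators on $\mathscr F$ generated by $\{a(\xi):\xi\in\ell^2\}$, and let $\mathcal U(\mathrm{CAR}(\ell^2))_u$ be its unitary group with the operator norm topology. For a unitary $u$ on $\ell^2$ let $\Gamma(u)=\bigoplus_{p\ge0}\wedge^pu$ be its second quantization, where $\wedge^pu$ is the restriction of $\otimes^pu$ to $\wedge^p\ell^2$. **Theorem.** For every $u\in\mathcal U_1(\ell^2)$ the operator $\Gamma(u)$ belongs to $\mathcal U(\mathrm{CAR}(\ell^2))$, and $u\mapsto\Gamma(u)$ is an isomorphism of topological groups (a group isomorphism and a homeomorphism) from $\mathcal U_1(\ell^2)$ onto a closed subgroup of $\mathcal U(\mathrm{CAR}(\ell^2))_u$. In particular, $\mathcal U_1(\ell^2)$ is norm unitarily representable (NUR): it is a Hausdorff topological group that is isomorphic, as a topological group, to a closed subgroup of the unitary group $\mathcal U(H)$ of some complex Hilbert space $H$, equipped with the norm topology. -/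

import Mathlib

open scoped ENNReal InnerProductSpace

namespace CARFock

section TraceNorm

variable {E : Type*} [NormedAddCommGroup E] [InnerProductSpace ℂ E] [CompleteSpace E]

/-- The value of the usual trace of `𝔹(E)` on a positive operator `T`, computed in the Hilbert
basis `b`, as an element of `[0, ∞]`. -/
noncomputable def opTrace (b : HilbertBasis ℕ ℂ E) (T : E →L[ℂ] E) : ℝ≥0∞ :=
  ∑' i, ENNReal.ofReal (RCLike.re ⟪b i, T (b i)⟫_ℂ)

/-- The trace norm `‖x‖₁ = Tr |x|`, with values in `[0, ∞]`. -/
noncomputable def eTraceNorm (b : HilbertBasis ℕ ℂ E) (x : E →L[ℂ] E) : ℝ≥0∞ :=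
  opTrace b (CFC.abs x)

/-- The square of the Hilbert-Schmidt norm of `T`, with values in `[0, ∞]`. -/
noncomputable def hsSq (b : HilbertBasis ℕ ℂ E) (T : E →L[ℂ] E) : ℝ≥0∞ :=
  ∑' i, ‖T (b i)‖ₑ ^ 2

theorem enorm_sq_eq_tsum (b : HilbertBasis ℕ ℂ E) (v : E) :
    ‖v‖ₑ ^ 2 = ∑' j, ‖⟪b j, v⟫_ℂ‖ₑ ^ 2 := by
  have h := b.hasSum_inner_mul_inner v v
  have h2 : HasSum (fun j => ‖⟪b j, v⟫_ℂ‖ ^ 2) (‖v‖ ^ 2) := by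
    have h3 := Complex.hasSum_re h
    have e1 : (⟪v, v⟫_ℂ).re = ‖v‖ ^ 2 := by
      rw [← inner_self_eq_norm_sq (𝕜 := ℂ) v]; rfl
    rw [e1] at h3
    convert h3 using 2 with j
    rw [← inner_conj_symm v (b j), Complex.conj_mul']
    norm_cast
  have h4 := h2.tsum_eq
  rw [show ‖v‖ₑ ^ 2 = ENNReal.ofReal (‖v‖ ^ 2) by
    rw [ENNReal.ofReal_pow (norm_nonneg _), ofReal_norm], ← h4,
    ENNReal.ofReal_tsum_of_nonneg (fun _ => by positivity) h2.summable]
  congr 1; ext j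
  rw [ENNReal.ofReal_pow (norm_nonneg _), ofReal_norm]

theorem hsSq_star (b : HilbertBasis ℕ ℂ E) (T : E →L[ℂ] E) : hsSq b (star T) = hsSq b T := by
  unfold hsSq
  simp_rw [enorm_sq_eq_tsum b]
  rw [ENNReal.tsum_comm]
  congr 1; ext j; congr 1; ext i
  rw [ContinuousLinearMap.star_eq_adjoint, ContinuousLinearMap.adjoint_inner_right,
    ← inner_conj_symm, RCLike.enorm_conj]

theorem hsSq_mul_le (b : HilbertBasis ℕ ℂ E) (c T : E →L[ℂ] E) (hc : ‖c‖ ≤ 1) :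
    hsSq b (c * T) ≤ hsSq b T := by
  refine ENNReal.tsum_le_tsum fun i => ?_
  gcongr
  rw [enorm_eq_nnnorm, enorm_eq_nnnorm, ENNReal.coe_le_coe, ← NNReal.coe_le_coe]
  simpa using (c.le_opNorm (T (b i))).trans (mul_le_of_le_one_left (norm_nonneg _) hc)

theorem opTrace_star_mul_self (b : HilbertBasis ℕ ℂ E) (T : E →L[ℂ] E) :
    opTrace b (star T * T) = hsSq b T := by
  unfold opTrace hsSq
  congr 1; ext i
  rw [mul_apply_eq_comp, ContinuousLinearMap.star_eq_adjoint,
    ContinuousLinearMap.adjoint_inner_right, inner_self_eq_norm_sq,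
    ENNReal.ofReal_pow (norm_nonneg _), ofReal_norm]

theorem opTrace_nonneg_eq (b : HilbertBasis ℕ ℂ E) {r : E →L[ℂ] E} (hr : 0 ≤ r) :
    opTrace b r = hsSq b (CFC.sqrt r) := by
  rw [← opTrace_star_mul_self, (CFC.sqrt_nonneg r).isSelfAdjoint.star_eq,
    CFC.sqrt_mul_sqrt_self r hr]

/-- Approximate polar decomposition: `x * s` plays the role of the polar part of `x`. -/
theorem exists_approx_polar (x : E →L[ℂ] E) {ε : ℝ} (hε : 0 < ε) :
    ∃ s : E →L[ℂ] E, ‖x * s‖ ≤ 1 ∧ ‖x - x * s * CFC.abs x‖ ≤ ε ∧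
      ‖CFC.abs x - star (x * s) * x‖ ≤ ε := by
  set r := CFC.abs x with hr
  have hr0 : 0 ≤ r := CFC.abs_nonneg x
  have hrs : star r = r := hr0.isSelfAdjoint.star_eq
  have hx : ∀ v, ‖x v‖ = ‖r v‖ := by
    intro v
    have h1 : ∀ y : E →L[ℂ] E, ‖y v‖ ^ 2 = RCLike.re ⟪v, (star y * y) v⟫_ℂ := by
      intro y
      rw [mul_apply_eq_comp, ContinuousLinearMap.star_eq_adjoint,
        ContinuousLinearMap.adjoint_inner_right, inner_self_eq_norm_sq]
    have : ‖x v‖ ^ 2 = ‖r v‖ ^ 2 := by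
      rw [h1 x, h1 r, hrs, hr, CFC.abs_mul_abs]
    exact (pow_left_inj₀ (norm_nonneg _) (norm_nonneg _) two_ne_zero).1 this
  have hpos : IsStrictlyPositive (r + algebraMap ℝ (E →L[ℂ] E) ε) := by
    refine IsStrictlyPositive.nonneg_add hr0 ?_
    exact isStrictlyPositive_algebraMap hε
  obtain ⟨q, hq⟩ := hpos.isUnit
  set s : E →L[ℂ] E := ((q⁻¹ : (E →L[ℂ] E)ˣ) : E →L[ℂ] E) with hs
  have h1 : (r + algebraMap ℝ (E →L[ℂ] E) ε) * s = 1 := by rw [← hq]; simp [hs]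
  have h2 : s * (r + algebraMap ℝ (E →L[ℂ] E) ε) = 1 := by rw [← hq]; simp [hs]
  have hss : star s = s := by
    have h3 := congrArg star h1
    rw [star_mul, star_add, hrs, star_one,
      (IsSelfAdjoint.algebraMap _ (IsSelfAdjoint.all ε)).star_eq] at h3
    calc star s = star s * ((r + algebraMap ℝ (E →L[ℂ] E) ε) * s) := by rw [h1, mul_one]
      _ = s := by rw [← mul_assoc, h3, one_mul]
  have hb : ‖r * s‖ ≤ 1 := by
    refine ContinuousLinearMap.opNorm_le_bound _ zero_le_one fun v => ?_
    have hv : v = r (s v) + (ε : ℂ) • (s v) := by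
      have := congrArg (fun T : E →L[ℂ] E => T v) h1
      simpa [add_mul, Algebra.algebraMap_eq_smul_one] using this.symm
    rw [one_mul]
    have hn : 0 ≤ RCLike.re ⟪r (s v), s v⟫_ℂ :=
      ((ContinuousLinearMap.nonneg_iff_isPositive _).1 hr0).re_inner_nonneg_left _
    have hsq : ‖r (s v)‖ ^ 2 ≤ ‖v‖ ^ 2 := by
      conv_rhs => rw [hv, norm_add_sq (𝕜 := ℂ)]
      have : RCLike.re ⟪r (s v), (ε : ℂ) • s v⟫_ℂ = ε * RCLike.re ⟪r (s v), s v⟫_ℂ := by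
        rw [inner_smul_right]; simp
      rw [this]
      have : 0 ≤ ε * RCLike.re ⟪r (s v), s v⟫_ℂ := mul_nonneg hε.le hn
      nlinarith [sq_nonneg ‖(ε : ℂ) • s v‖]
    exact (pow_le_pow_iff_left₀ (norm_nonneg _) (norm_nonneg _) two_ne_zero).1 hsq
  have hxs : ‖x * s‖ ≤ 1 := by
    refine ContinuousLinearMap.opNorm_le_bound _ zero_le_one fun v => ?_
    rw [mul_apply_eq_comp, hx]
    exact (r * s).le_of_opNorm_le hb v
  refine ⟨s, hxs, ?_, ?_⟩
  · have : x - x * s * r = ε • (x * s) := by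
      calc x - x * s * r = x * (s * (r + algebraMap ℝ (E →L[ℂ] E) ε)) - x * s * r := by
            rw [h2, mul_one]
        _ = x * s * algebraMap ℝ (E →L[ℂ] E) ε := by noncomm_ring
        _ = ε • (x * s) := by rw [Algebra.algebraMap_eq_smul_one, mul_smul_comm, mul_one]
    rw [this, norm_smul, Real.norm_of_nonneg hε.le]
    exact mul_le_of_le_one_right hε.le hxs
  · have : r - star (x * s) * x = ε • (star (r * s)) := by
      rw [star_mul, star_mul, hss, mul_assoc, ← CFC.abs_mul_abs, ← hr, hrs]
      calc r - s * (r * r) = (s * (r + algebraMap ℝ (E →L[ℂ] E) ε)) * r - s * (r * r) := by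
            rw [h2, one_mul]
        _ = s * algebraMap ℝ (E →L[ℂ] E) ε * r := by noncomm_ring
        _ = ε • (s * r) := by
          rw [Algebra.algebraMap_eq_smul_one, mul_smul_comm, mul_one, smul_mul_assoc]
    rw [this, norm_smul, Real.norm_of_nonneg hε.le, norm_star]
    exact mul_le_of_le_one_right hε.le hb

theorem sum_enorm_inner_le (b : HilbertBasis ℕ ℂ E) (x c : E →L[ℂ] E) (hc : ‖c‖ ≤ 1)
    (S : Finset ℕ) : ∑ i ∈ S, ‖⟪b i, c (x (b i))⟫_ℂ‖ₑ ≤ eTraceNorm b x := by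
  -- bound for `d * |x|`
  have key : ∀ d : E →L[ℂ] E, ‖d‖ ≤ 1 →
      ∑ i ∈ S, ‖⟪b i, d (CFC.abs x (b i))⟫_ℂ‖ₑ ≤ eTraceNorm b x := by
    intro d hd
    set q := CFC.sqrt (CFC.abs x) with hq
    have hqs : star q = q := (CFC.sqrt_nonneg _).isSelfAdjoint.star_eq
    have hqq : q * q = CFC.abs x := CFC.sqrt_mul_sqrt_self _ (CFC.abs_nonneg x)
    have hT : eTraceNorm b x = hsSq b q := opTrace_nonneg_eq b (CFC.abs_nonneg x)
    have h1 : ∀ i, ‖⟪b i, d (CFC.abs x (b i))⟫_ℂ‖ₑ ≤ ‖star (d * q) (b i)‖ₑ * ‖q (b i)‖ₑ := by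
      intro i
      have : ⟪b i, d (CFC.abs x (b i))⟫_ℂ = ⟪star (d * q) (b i), q (b i)⟫_ℂ := by
        rw [ContinuousLinearMap.star_eq_adjoint, ContinuousLinearMap.adjoint_inner_left, ← hqq]
        rfl
      rw [this]
      simp only [enorm_eq_nnnorm]
      exact_mod_cast norm_inner_le_norm (𝕜 := ℂ) _ _
    calc ∑ i ∈ S, ‖⟪b i, d (CFC.abs x (b i))⟫_ℂ‖ₑ
        ≤ ∑ i ∈ S, ‖star (d * q) (b i)‖ₑ * ‖q (b i)‖ₑ := Finset.sum_le_sum fun i _ => h1 i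
      _ ≤ (∑ i ∈ S, ‖star (d * q) (b i)‖ₑ ^ (2 : ℝ)) ^ (1 / (2 : ℝ)) *
          (∑ i ∈ S, ‖q (b i)‖ₑ ^ (2 : ℝ)) ^ (1 / (2 : ℝ)) :=
        ENNReal.inner_le_Lp_mul_Lq S _ _ (by constructor <;> norm_num)
      _ ≤ (hsSq b q) ^ (1 / (2 : ℝ)) * (hsSq b q) ^ (1 / (2 : ℝ)) := by
        simp only [ENNReal.rpow_ofNat]
        gcongr
        · refine (ENNReal.sum_le_tsum S).trans ?_
          refine (hsSq_star b (d * q)).le.trans ?_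
          exact hsSq_mul_le b d q hd
        · exact ENNReal.sum_le_tsum S
      _ = eTraceNorm b x := by
        rw [← ENNReal.rpow_add_of_nonneg _ _ (by norm_num) (by norm_num), hT]; norm_num
  refine ENNReal.le_of_forall_pos_le_add fun ε hε _ => ?_
  set δ : ℝ := ε / (S.card + 1) with hδ
  have hδ0 : 0 < δ := by have : (0 : ℝ) < ε := hε; positivity
  obtain ⟨s, hs1, hs2, -⟩ := exists_approx_polar x hδ0
  have hcs : ‖c * (x * s)‖ ≤ 1 :=
    (norm_mul_le _ _).trans (mul_le_one₀ hc (norm_nonneg _) hs1)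
  have hle : ∀ i, ‖⟪b i, c (x (b i))⟫_ℂ‖ₑ ≤
      ‖⟪b i, (c * (x * s)) (CFC.abs x (b i))⟫_ℂ‖ₑ + ENNReal.ofReal δ := by
    intro i
    have e1 : ⟪b i, c (x (b i))⟫_ℂ = ⟪b i, (c * (x * s)) (CFC.abs x (b i))⟫_ℂ +
        ⟪b i, c ((x - x * s * CFC.abs x) (b i))⟫_ℂ := by
      rw [← inner_add_right]; simp
    rw [e1]
    refine (enorm_add_le _ _).trans ?_
    gcongr
    rw [← ofReal_norm]
    apply ENNReal.ofReal_le_ofReal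
    have hb : ‖b i‖ = 1 := b.orthonormal.1 i
    calc ‖⟪b i, c ((x - x * s * CFC.abs x) (b i))⟫_ℂ‖
        ≤ ‖b i‖ * ‖c ((x - x * s * CFC.abs x) (b i))‖ := norm_inner_le_norm _ _
      _ ≤ 1 * (1 * (δ * 1)) := by
        rw [hb]; gcongr
        refine (c.le_of_opNorm_le hc _).trans ?_
        gcongr
        rw [← hb]
        exact ContinuousLinearMap.le_of_opNorm_le _ hs2 _
      _ = δ := by ring
  calc ∑ i ∈ S, ‖⟪b i, c (x (b i))⟫_ℂ‖ₑ
      ≤ ∑ i ∈ S, (‖⟪b i, (c * (x * s)) (CFC.abs x (b i))⟫_ℂ‖ₑ + ENNReal.ofReal δ) :=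
        Finset.sum_le_sum fun i _ => hle i
    _ ≤ eTraceNorm b x + ε := by
      rw [Finset.sum_add_distrib]
      gcongr
      · exact key _ hcs
      · rw [Finset.sum_const, nsmul_eq_mul, ← ENNReal.ofReal_natCast, ← ENNReal.ofReal_mul (by simp)]
        rw [← ENNReal.ofReal_coe_nnreal]
        apply ENNReal.ofReal_le_ofReal
        rw [hδ, mul_div_assoc', div_le_iff₀ (by positivity)]
        nlinarith [NNReal.coe_nonneg ε]

theorem eTraceNorm_le_of_forall (b : HilbertBasis ℕ ℂ E) (x : E →L[ℂ] E) (M : ℝ≥0∞)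
    (h : ∀ c : E →L[ℂ] E, ‖c‖ ≤ 1 → ∀ S : Finset ℕ, ∑ i ∈ S, ‖⟪b i, c (x (b i))⟫_ℂ‖ₑ ≤ M) :
    eTraceNorm b x ≤ M := by
  unfold eTraceNorm opTrace
  rw [ENNReal.tsum_eq_iSup_sum]
  refine iSup_le fun S => ?_
  refine ENNReal.le_of_forall_pos_le_add fun ε hε _ => ?_
  set δ : ℝ := ε / (S.card + 1) with hδ
  have hδ0 : 0 < δ := by have : (0 : ℝ) < ε := hε; positivity
  obtain ⟨s, hs1, -, hs2⟩ := exists_approx_polar x hδ0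
  have hle : ∀ i, ENNReal.ofReal (RCLike.re ⟪b i, CFC.abs x (b i)⟫_ℂ) ≤
      ‖⟪b i, star (x * s) (x (b i))⟫_ℂ‖ₑ + ENNReal.ofReal δ := by
    intro i
    have hb : ‖b i‖ = 1 := b.orthonormal.1 i
    have e1 : ⟪b i, CFC.abs x (b i)⟫_ℂ = ⟪b i, star (x * s) (x (b i))⟫_ℂ +
        ⟪b i, (CFC.abs x - star (x * s) * x) (b i)⟫_ℂ := by
      rw [← inner_add_right, sub_apply, mul_apply_eq_comp,
        add_sub_cancel]
    have e2 : RCLike.re ⟪b i, CFC.abs x (b i)⟫_ℂ ≤ ‖⟪b i, star (x * s) (x (b i))⟫_ℂ‖ + δ := by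
      refine (RCLike.re_le_norm _).trans ?_
      rw [e1]
      refine (norm_add_le _ _).trans ?_
      gcongr
      refine (norm_inner_le_norm _ _).trans ?_
      rw [hb, one_mul]
      refine (ContinuousLinearMap.le_of_opNorm_le _ hs2 _).trans ?_
      rw [hb, mul_one]
    refine (ENNReal.ofReal_le_ofReal e2).trans ?_
    rw [ENNReal.ofReal_add (norm_nonneg _) hδ0.le, ofReal_norm]
  calc _ ≤ ∑ i ∈ S, (‖⟪b i, star (x * s) (x (b i))⟫_ℂ‖ₑ + ENNReal.ofReal δ) :=
        Finset.sum_le_sum fun i _ => hle i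
    _ ≤ M + ε := by
      rw [Finset.sum_add_distrib]
      gcongr
      · exact h _ (by rwa [norm_star]) S
      · rw [Finset.sum_const, nsmul_eq_mul, ← ENNReal.ofReal_natCast, ← ENNReal.ofReal_mul (by simp)]
        rw [← ENNReal.ofReal_coe_nnreal]
        apply ENNReal.ofReal_le_ofReal
        rw [hδ, mul_div_assoc', div_le_iff₀ (by positivity)]
        nlinarith [NNReal.coe_nonneg ε]

theorem eTraceNorm_add_le (b : HilbertBasis ℕ ℂ E) (x y : E →L[ℂ] E) :
    eTraceNorm b (x + y) ≤ eTraceNorm b x + eTraceNorm b y := by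
  refine eTraceNorm_le_of_forall b _ _ fun c hc S => ?_
  calc ∑ i ∈ S, ‖⟪b i, c ((x + y) (b i))⟫_ℂ‖ₑ
      ≤ ∑ i ∈ S, (‖⟪b i, c (x (b i))⟫_ℂ‖ₑ + ‖⟪b i, c (y (b i))⟫_ℂ‖ₑ) := by
        refine Finset.sum_le_sum fun i _ => ?_
        rw [add_apply, map_add, inner_add_right]
        exact enorm_add_le _ _
    _ ≤ _ := by
      rw [Finset.sum_add_distrib]
      exact add_le_add (sum_enorm_inner_le b x c hc S) (sum_enorm_inner_le b y c hc S)

theorem eTraceNorm_zero (b : HilbertBasis ℕ ℂ E) : eTraceNorm b (0 : E →L[ℂ] E) = 0 := by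
  simp [eTraceNorm, opTrace]

theorem eTraceNorm_neg (b : HilbertBasis ℕ ℂ E) (x : E →L[ℂ] E) :
    eTraceNorm b (-x) = eTraceNorm b x := by
  rw [eTraceNorm, CFC.abs_neg, eTraceNorm]

theorem eTraceNorm_eq_zero (b : HilbertBasis ℕ ℂ E) {x : E →L[ℂ] E} (h : eTraceNorm b x = 0) :
    x = 0 := by
  rw [eTraceNorm, opTrace_nonneg_eq b (CFC.abs_nonneg x), hsSq, ENNReal.tsum_eq_zero] at h
  have hq : CFC.sqrt (CFC.abs x) = 0 := by
    refine ContinuousLinearMap.ext_on (s := Set.range b) ?_ ?_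
    · exact Submodule.dense_iff_topologicalClosure_eq_top.2 b.dense_span
    · rintro _ ⟨i, rfl⟩
      simpa using h i
  rw [← CFC.abs_eq_zero_iff, ← CFC.sqrt_mul_sqrt_self (CFC.abs x) (CFC.abs_nonneg x), hq, mul_zero]

theorem eTraceNorm_unitary_mul (b : HilbertBasis ℕ ℂ E) (u : unitary (E →L[ℂ] E))
    (x : E →L[ℂ] E) : eTraceNorm b (u * x) = eTraceNorm b x := by
  rw [eTraceNorm, eTraceNorm, CFC.abs, CFC.abs, star_mul, mul_assoc, ← mul_assoc (star (u : E →L[ℂ] E)),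
    Unitary.coe_star_mul_self, one_mul]

theorem eTraceNorm_mul_unitary (b : HilbertBasis ℕ ℂ E) (u : unitary (E →L[ℂ] E))
    (x : E →L[ℂ] E) : eTraceNorm b (x * u) = eTraceNorm b x := by
  have key : ∀ (u : unitary (E →L[ℂ] E)) (x : E →L[ℂ] E),
      eTraceNorm b (x * u) ≤ eTraceNorm b x := by
    intro u x
    have hu : ‖star (u : E →L[ℂ] E)‖ ≤ 1 := by
      rw [norm_star]
      have h1 : ‖(u : E →L[ℂ] E)‖ * ‖(u : E →L[ℂ] E)‖ ≤ 1 := by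
        rw [← CStarRing.norm_star_mul_self, Unitary.coe_star_mul_self]
        exact ContinuousLinearMap.norm_id_le
      nlinarith [norm_nonneg (u : E →L[ℂ] E)]
    set q := CFC.sqrt (CFC.abs x) with hq
    have hqs : star q = q := (CFC.sqrt_nonneg _).isSelfAdjoint.star_eq
    have hqq : q * q = CFC.abs x := CFC.sqrt_mul_sqrt_self _ (CFC.abs_nonneg x)
    have habs : CFC.abs (x * (u : E →L[ℂ] E)) =
        star (q * (u : E →L[ℂ] E)) * (q * (u : E →L[ℂ] E)) := by
      refine CFC.sqrt_unique ?_ (star_mul_self_nonneg _)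
      rw [star_mul, hqs]
      calc _ = star (u : E →L[ℂ] E) * (q * q) * ((u : E →L[ℂ] E) * star (u : E →L[ℂ] E)) *
            (q * q) * u := by noncomm_ring
        _ = star (u : E →L[ℂ] E) * (CFC.abs x * CFC.abs x) * u := by
          rw [Unitary.mul_star_self_of_mem u.2, hqq, mul_one]; noncomm_ring
        _ = _ := by rw [CFC.abs_mul_abs, star_mul]; noncomm_ring
    rw [eTraceNorm, habs, opTrace_star_mul_self, ← hsSq_star, star_mul, hqs, eTraceNorm,
      opTrace_nonneg_eq b (CFC.abs_nonneg x)]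
    exact hsSq_mul_le b _ _ hu
  refine (key u x).antisymm ?_
  have := key (star u) (x * u)
  rwa [mul_assoc, Unitary.coe_star, Unitary.mul_star_self_of_mem u.2, mul_one] at this

end TraceNorm

/-- The Hilbert space `ℓ²` of square-summable complex sequences. -/
abbrev Ell2 : Type := lp (fun _ : ℕ => ℂ) 2

noncomputable instance : NormedAddCommGroup Ell2 := lp.normedAddCommGroup

noncomputable instance : InnerProductSpace ℂ Ell2 := lp.instInnerProductSpace

instance : CompleteSpace Ell2 := lp.completeSpace

/-- The standard Hilbert basis of `ℓ²`. -/
noncomputable def ell2Basis : HilbertBasis ℕ ℂ Ell2 :=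
  HilbertBasis.ofRepr (LinearIsometryEquiv.refl ℂ Ell2)

/-- The unitaries `u` of `ℓ²` for which `u - 1` is of trace class. -/
noncomputable def schattenOneSubgroup : Subgroup (unitary (Ell2 →L[ℂ] Ell2)) where
  carrier := {u | eTraceNorm ell2Basis ((u : Ell2 →L[ℂ] Ell2) - 1) ≠ ∞}
  one_mem' := by simp [eTraceNorm_zero]
  mul_mem' := by
    intro u v hu hv
    have h : ((u * v : unitary (Ell2 →L[ℂ] Ell2)) : Ell2 →L[ℂ] Ell2) - 1 =
        ((u : Ell2 →L[ℂ] Ell2) - 1) * (v : Ell2 →L[ℂ] Ell2) + ((v : Ell2 →L[ℂ] Ell2) - 1) := by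
      push_cast; noncomm_ring
    refine ne_top_of_le_ne_top (ENNReal.add_ne_top.2 ⟨hu, hv⟩) ?_
    rw [h]
    exact (eTraceNorm_add_le _ _ _).trans (by rw [eTraceNorm_mul_unitary])
  inv_mem' := by
    intro u hu
    have h : ((u⁻¹ : unitary (Ell2 →L[ℂ] Ell2)) : Ell2 →L[ℂ] Ell2) - 1 =
        -(((u⁻¹ : unitary (Ell2 →L[ℂ] Ell2)) : Ell2 →L[ℂ] Ell2) * ((u : Ell2 →L[ℂ] Ell2) - 1)) := by
      rw [mul_sub, ← Submonoid.coe_mul, inv_mul_cancel]; simp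
    change eTraceNorm _ _ ≠ ∞
    rw [h, eTraceNorm_neg, eTraceNorm_unitary_mul]
    exact hu

/-- The Schatten `1`-unitary group `𝒰₁(ℓ²)`.  It is a type of its own, because its topology is not
the subspace topology of the operator norm. -/
noncomputable def SchattenOneUnitary : Type := schattenOneSubgroup

namespace SchattenOneUnitary

noncomputable instance : Group SchattenOneUnitary := schattenOneSubgroup.toGroup

/-- The underlying unitary operator. -/
noncomputable def toUnitary : SchattenOneUnitary →* unitary (Ell2 →L[ℂ] Ell2) := schattenOneSubgroup.subtype

theorem eTraceNorm_sub_ne_top (u v : SchattenOneUnitary) :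
    eTraceNorm ell2Basis ((toUnitary u : Ell2 →L[ℂ] Ell2) - (toUnitary v : Ell2 →L[ℂ] Ell2)) ≠ ∞ := by
  have hu : eTraceNorm ell2Basis ((toUnitary u : Ell2 →L[ℂ] Ell2) - 1) ≠ ∞ := u.2
  have hv : eTraceNorm ell2Basis ((toUnitary v : Ell2 →L[ℂ] Ell2) - 1) ≠ ∞ := v.2
  refine ne_top_of_le_ne_top (ENNReal.add_ne_top.2 ⟨hu, hv⟩) ?_
  rw [← eTraceNorm_neg _ ((toUnitary v : Ell2 →L[ℂ] Ell2) - 1)]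
  refine le_of_eq_of_le ?_ (eTraceNorm_add_le _ _ _)
  congr 1; abel

/-- The group `𝒰₁(ℓ²)` carries the metric `d(u, v) = ‖u - v‖₁`. -/
noncomputable instance : MetricSpace SchattenOneUnitary where
  dist u v := (eTraceNorm ell2Basis
    ((toUnitary u : Ell2 →L[ℂ] Ell2) - (toUnitary v : Ell2 →L[ℂ] Ell2))).toReal
  dist_self u := by simp [eTraceNorm_zero]
  dist_comm u v := by rw [← eTraceNorm_neg, neg_sub]
  dist_triangle u v w := by
    rw [← ENNReal.toReal_add (eTraceNorm_sub_ne_top u v) (eTraceNorm_sub_ne_top v w)]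
    refine ENNReal.toReal_mono (ENNReal.add_ne_top.2
      ⟨eTraceNorm_sub_ne_top u v, eTraceNorm_sub_ne_top v w⟩) ?_
    refine le_of_eq_of_le ?_ (eTraceNorm_add_le _ _ _)
    congr 1; abel
  eq_of_dist_eq_zero {u v} h := by
    have h0 := (ENNReal.toReal_eq_zero_iff _).1 h
    have h1 := eTraceNorm_eq_zero _ (h0.resolve_right (eTraceNorm_sub_ne_top u v))
    exact Subtype.ext (Subtype.ext (sub_eq_zero.1 h1))

end SchattenOneUnitary

section TensorPower

/-- The `p`-fold tensor product Hilbert space `⊗ᵖ ℓ²`, realised as `ℓ²(ℕᵖ)`: the elementary tensor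
`ξ₁ ⊗ ⋯ ⊗ ξₚ` is the function `n ↦ ξ₁(n₁) ⋯ ξₚ(nₚ)`, see `elemTensor`. -/
abbrev TensorPow (p : ℕ) : Type := lp (fun _ : Fin p → ℕ => ℂ) 2

theorem memlp_two_iff {α : Type} {F : α → Type} [∀ i, NormedAddCommGroup (F i)] {f : ∀ i, F i} :
    Memℓp f 2 ↔ Summable fun i => ‖f i‖ ^ 2 := by
  rw [memℓp_gen_iff (by norm_num)]; norm_num

/-- The element of an `ℓ²` space given by a square-summable family. -/
noncomputable def mkL2 {α : Type} {F : α → Type} [∀ i, NormedAddCommGroup (F i)] (f : ∀ i, F i)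
    (hf : Summable fun i => ‖f i‖ ^ 2) : lp F 2 :=
  ⟨f, memlp_two_iff.2 hf⟩

theorem mkL2_apply {α : Type} {F : α → Type} [∀ i, NormedAddCommGroup (F i)] (f : ∀ i, F i)
    (hf : Summable fun i => ‖f i‖ ^ 2) (i : α) : mkL2 f hf i = f i := rfl

theorem lp_two_norm_sq {α : Type} {F : α → Type} [∀ i, NormedAddCommGroup (F i)]
    (f : lp F 2) : HasSum (fun i => ‖f i‖ ^ 2) (‖f‖ ^ 2) := by
  have := lp.hasSum_norm (p := 2) (by norm_num) f
  simpa using this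

theorem ell2_norm_sq {α : Type} (f : lp (fun _ : α => ℂ) 2) :
    HasSum (fun i => ‖f i‖ ^ 2) (‖f‖ ^ 2) := lp_two_norm_sq f

theorem ell2_summable {α : Type} (f : lp (fun _ : α => ℂ) 2) :
    Summable (fun i => ‖f i‖ ^ 2) := (ell2_norm_sq f).summable

theorem ell2_norm_eq {α : Type} {f : lp (fun _ : α => ℂ) 2} {c : ℝ} (hc : 0 ≤ c)
    (h : HasSum (fun i => ‖f i‖ ^ 2) (c ^ 2)) : ‖f‖ = c :=
  (pow_left_inj₀ (norm_nonneg _) hc two_ne_zero).1 ((ell2_norm_sq f).unique h)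

theorem summable_and_tsum_prod (p : ℕ) (f : Fin p → ℕ → ℂ) (hf : ∀ i, Summable fun k => ‖f i k‖) :
    (Summable fun n : Fin p → ℕ => ‖∏ i, f i (n i)‖) ∧
      ∑' n : Fin p → ℕ, ∏ i, f i (n i) = ∏ i, ∑' k, f i k := by
  induction p with
  | zero => simp [Summable.of_finite]
  | succ p ih =>
    obtain ⟨h1, h2⟩ := ih (fun i => f i.succ) (fun i => hf i.succ)
    let e : ℕ × (Fin p → ℕ) ≃ (Fin (p + 1) → ℕ) := Fin.consEquiv (fun _ => ℕ)
    have he : ∀ q : ℕ × (Fin p → ℕ), ∏ i, f i (e q i) = f 0 q.1 * ∏ i, f (Fin.succ i) (q.2 i) := by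
      intro q; simp [e, Fin.prod_univ_succ, Fin.consEquiv]
    constructor
    · rw [← e.summable_iff]
      have := (hf 0).mul_norm h1
      refine this.congr fun q => ?_
      simp only [Function.comp, he]
    · rw [← e.tsum_eq, Fin.prod_univ_succ, ← h2]
      simp_rw [he]
      rw [tsum_mul_tsum_of_summable_norm (hf 0) h1]

/-- The elementary tensor `ξ₁ ⊗ ⋯ ⊗ ξₚ`. -/
noncomputable def elemTensor {p : ℕ} (ξ : Fin p → Ell2) : TensorPow p :=
  mkL2 (fun n => ∏ i, ξ i (n i)) (by
    have h := (summable_and_tsum_prod p (fun i k => ((‖ξ i k‖ ^ 2 : ℝ) : ℂ)) (fun i => by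
      simpa using ell2_summable (ξ i))).1
    refine h.congr fun n => ?_
    simp [Finset.prod_pow])

theorem elemTensor_apply {p : ℕ} (ξ : Fin p → Ell2) (n : Fin p → ℕ) :
    elemTensor ξ n = ∏ i, ξ i (n i) := rfl

theorem inner_elemTensor {p : ℕ} (ξ η : Fin p → Ell2) :
    ⟪elemTensor ξ, elemTensor η⟫_ℂ = ∏ i, ⟪ξ i, η i⟫_ℂ := by
  have hs : ∀ i, Summable fun k => ‖⟪ξ i k, η i k⟫_ℂ‖ := fun i => by
    refine Summable.of_nonneg_of_le (fun _ => norm_nonneg _) (fun k => norm_inner_le_norm _ _) ?_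
    exact lp.summable_mul (p := 2) (q := 2) (by constructor <;> norm_num) (ξ i) (η i)
  simp_rw [lp.inner_eq_tsum]
  rw [← (summable_and_tsum_prod p (fun i k => ⟪ξ i k, η i k⟫_ℂ) hs).2]
  congr 1; ext n
  simp [elemTensor_apply, Finset.prod_mul_distrib]

/-- Relabelling of the index set of an `ℓ²` space. -/
noncomputable def lpReindexLin {α β : Type} (e : α ≃ β) :
    lp (fun _ : α => ℂ) 2 →ₗ[ℂ] lp (fun _ : β => ℂ) 2 where
  toFun f := mkL2 (fun b => f (e.symm b)) (by
    have h := e.symm.summable_iff.2 (ell2_summable f)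
    exact h)
  map_add' f g := by ext b; rfl
  map_smul' c f := by ext b; rfl

theorem norm_lpReindexLin {α β : Type} (e : α ≃ β) (f : lp (fun _ : α => ℂ) 2) :
    ‖lpReindexLin e f‖ = ‖f‖ := by
  have h := e.symm.hasSum_iff.2 (ell2_norm_sq f)
  exact ell2_norm_eq (norm_nonneg _) h

/-- Relabelling of the index set of an `ℓ²` space, as an isometry. -/
noncomputable def lpReindex {α β : Type} (e : α ≃ β) :
    lp (fun _ : α => ℂ) 2 →ₗᵢ[ℂ] lp (fun _ : β => ℂ) 2 :=
  ⟨lpReindexLin e, norm_lpReindexLin e⟩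

theorem lpReindex_apply {α β : Type} (e : α ≃ β) (f : lp (fun _ : α => ℂ) 2) (b : β) :
    lpReindex e f b = f (e.symm b) := rfl

/-- The action of the symmetric group on `⊗ᵖ ℓ²`, with
`U(σ) (ξ₁ ⊗ ⋯ ⊗ ξₚ) = ξ_{σ(1)} ⊗ ⋯ ⊗ ξ_{σ(p)}`. -/
noncomputable def permOp {p : ℕ} (σ : Equiv.Perm (Fin p)) : TensorPow p →ₗᵢ[ℂ] TensorPow p :=
  lpReindex (Equiv.arrowCongr σ.symm (Equiv.refl ℕ))

theorem permOp_apply {p : ℕ} (σ : Equiv.Perm (Fin p)) (f : TensorPow p) (n : Fin p → ℕ) :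
    permOp σ f n = f (fun i => n (σ.symm i)) := rfl

theorem permOp_elemTensor {p : ℕ} (σ : Equiv.Perm (Fin p)) (ξ : Fin p → Ell2) :
    permOp σ (elemTensor ξ) = elemTensor (fun i => ξ (σ i)) := by
  ext n
  rw [permOp_apply, elemTensor_apply, elemTensor_apply, ← Equiv.prod_comp σ]
  simp

theorem permOp_permOp {p : ℕ} (σ τ : Equiv.Perm (Fin p)) (f : TensorPow p) :
    permOp σ (permOp τ f) = permOp (τ * σ) f := by
  ext n
  rfl

/-- The antisymmetrizer `Aₚ = (1 / p!) ∑_σ sgn(σ) U(σ)`. -/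
noncomputable def antisymmetrizer (p : ℕ) : TensorPow p →L[ℂ] TensorPow p :=
  ((p.factorial : ℂ)⁻¹) • ∑ σ : Equiv.Perm (Fin p),
    ((Equiv.Perm.sign σ : ℤ) : ℂ) • (permOp σ).toContinuousLinearMap

theorem antisymmetrizer_apply {p : ℕ} (f : TensorPow p) : antisymmetrizer p f =
    ((p.factorial : ℂ)⁻¹) • ∑ σ : Equiv.Perm (Fin p),
      ((Equiv.Perm.sign σ : ℤ) : ℂ) • permOp σ f := by
  simp [antisymmetrizer]

/-- The antisymmetric tensor power `⋀ᵖ ℓ²`, i.e. the range of `Aₚ`. -/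
noncomputable def extPow (p : ℕ) : Submodule ℂ (TensorPow p) :=
  LinearMap.range (antisymmetrizer p).toLinearMap

theorem sign_mul_sign_self {p : ℕ} (σ : Equiv.Perm (Fin p)) :
    ((Equiv.Perm.sign σ : ℤ) : ℂ) * ((Equiv.Perm.sign σ : ℤ) : ℂ) = 1 := by
  rcases Int.units_eq_one_or (Equiv.Perm.sign σ) with h | h <;> simp [h]

theorem antisymmetrizer_of_forall {p : ℕ} {f : TensorPow p}
    (h : ∀ σ, permOp σ f = ((Equiv.Perm.sign σ : ℤ) : ℂ) • f) : antisymmetrizer p f = f := by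
  rw [antisymmetrizer_apply]
  simp_rw [h, smul_smul, sign_mul_sign_self]
  have : (p.factorial : ℂ) ≠ 0 := by exact_mod_cast p.factorial_ne_zero
  simp only [one_smul, Finset.sum_const, Finset.card_univ, Fintype.card_perm, Fintype.card_fin,
    ← Nat.cast_smul_eq_nsmul ℂ, smul_smul, inv_mul_cancel₀ this]

theorem mem_extPow_iff {p : ℕ} {f : TensorPow p} :
    f ∈ extPow p ↔ ∀ σ, permOp σ f = ((Equiv.Perm.sign σ : ℤ) : ℂ) • f := by
  constructor
  · rintro ⟨g, rfl⟩ σ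
    change permOp σ (antisymmetrizer p g) = _ • antisymmetrizer p g
    rw [antisymmetrizer_apply, map_smul, map_sum,
      smul_comm ((Equiv.Perm.sign σ : ℤ) : ℂ), Finset.smul_sum (r := ((Equiv.Perm.sign σ : ℤ) : ℂ)),
      ← Equiv.sum_comp (Equiv.mulRight σ) (fun τ => ((Equiv.Perm.sign σ : ℤ) : ℂ) •
        ((Equiv.Perm.sign τ : ℤ) : ℂ) • permOp τ g)]
    congr 1
    refine Finset.sum_congr rfl fun τ _ => ?_
    rw [map_smul, permOp_permOp, smul_smul]
    congr 1
    simp only [Equiv.coe_mulRight, Equiv.Perm.sign_mul, Units.val_mul, Int.cast_mul]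
    rw [mul_left_comm, sign_mul_sign_self, mul_one]
  · intro h
    exact ⟨f, antisymmetrizer_of_forall h⟩

instance extPow_complete (p : ℕ) : CompleteSpace (extPow p) := by
  have : IsClosed (extPow p : Set (TensorPow p)) := by
    have : (extPow p : Set (TensorPow p)) =
        ⋂ σ, {f | permOp σ f = ((Equiv.Perm.sign σ : ℤ) : ℂ) • f} := by
      ext f; simp [mem_extPow_iff]
    rw [this]
    exact isClosed_iInter fun σ => isClosed_eq (permOp σ).continuous (continuous_const_smul _)
  exact this.completeSpace_coe

end TensorPower

section Fock

/-- The Fermion Fock space over `ℓ²`: the Hilbert space direct sum of the `⋀ᵖ ℓ²`, `p ≥ 0`. -/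
noncomputable def FermionFock : Type := lp (fun p : ℕ => extPow p) 2

namespace FermionFock

noncomputable instance : NormedAddCommGroup FermionFock :=
  lp.normedAddCommGroup (E := fun p : ℕ => extPow p) (p := 2)

noncomputable instance : InnerProductSpace ℂ FermionFock :=
  lp.instInnerProductSpace (G := fun p : ℕ => extPow p)

instance : CompleteSpace FermionFock :=
  lp.completeSpace (E := fun p : ℕ => extPow p) (p := 2)

/-- A vector of the Fock space is the sequence of its components `ψ p ∈ ⋀ᵖ ℓ²`. -/
instance : CoeFun FermionFock fun _ => (p : ℕ) → extPow p where
  coe ψ := ψ.1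

theorem ext {ψ φ : FermionFock} (h : ∀ p, ψ p = φ p) : ψ = φ :=
  Subtype.ext (funext h)

theorem hasSum_norm_sq (ψ : FermionFock) : HasSum (fun p => ‖ψ p‖ ^ 2) (‖ψ‖ ^ 2) :=
  lp_two_norm_sq (F := fun p : ℕ => extPow p) ψ

/-- The vector of the Fock space with given components. -/
noncomputable def mk (f : (p : ℕ) → extPow p) (hf : Summable fun p => ‖f p‖ ^ 2) : FermionFock :=
  mkL2 f hf

end FermionFock

/-- Left tensoring `ψ ↦ ξ ⊗ ψ`, from `⊗ᵖ ℓ²` to `⊗ᵖ⁺¹ ℓ²`. -/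
noncomputable def tensorLeft (ξ : Ell2) (p : ℕ) : TensorPow p →ₗ[ℂ] TensorPow (p + 1) where
  toFun ψ := mkL2 (fun n => ξ (n 0) * ψ (Fin.tail n)) (by
    rw [← (Fin.consEquiv (fun _ => ℕ)).summable_iff]
    refine ((ell2_summable ξ).mul_of_nonneg (ell2_summable ψ)
      (fun _ => by positivity) (fun _ => by positivity)).congr fun q => ?_
    simp [Fin.consEquiv, mul_pow])
  map_add' f g := by ext n; exact mul_add _ _ _
  map_smul' c f := by ext n; exact mul_left_comm _ _ _

theorem tensorLeft_apply (ξ : Ell2) (p : ℕ) (ψ : TensorPow p) (n : Fin (p + 1) → ℕ) :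
    tensorLeft ξ p ψ n = ξ (n 0) * ψ (Fin.tail n) := rfl

theorem tensorLeft_elemTensor (ξ : Ell2) {p : ℕ} (η : Fin p → Ell2) :
    tensorLeft ξ p (elemTensor η) = elemTensor (Fin.cons ξ η : Fin (p + 1) → Ell2) := by
  ext n
  rw [tensorLeft_apply, elemTensor_apply, elemTensor_apply, Fin.prod_univ_succ]
  simp [Fin.tail]

theorem norm_tensorLeft (ξ : Ell2) {p : ℕ} (ψ : TensorPow p) :
    ‖tensorLeft ξ p ψ‖ = ‖ξ‖ * ‖ψ‖ := by
  have h0 := ell2_norm_sq ξ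
  have h1 := ell2_norm_sq ψ
  have hs := h0.summable.mul_of_nonneg h1.summable (fun _ => sq_nonneg _) (fun _ => sq_nonneg _)
  have h := h0.mul h1 hs
  refine ell2_norm_eq (mul_nonneg (norm_nonneg _) (norm_nonneg _)) ?_
  rw [mul_pow, ← (Fin.consEquiv (fun _ : Fin (p + 1) => ℕ)).hasSum_iff]
  refine h.congr_fun fun q => ?_
  rw [← mul_pow, ← norm_mul]
  rfl

theorem inner_antisymmetrizer {p : ℕ} {g : TensorPow p} (hg : g ∈ extPow p) (f : TensorPow p) :
    ⟪g, antisymmetrizer p f⟫_ℂ = ⟪g, f⟫_ℂ := by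
  have h : ∀ σ : Equiv.Perm (Fin p), ⟪g, permOp σ f⟫_ℂ = ((Equiv.Perm.sign σ : ℤ) : ℂ) * ⟪g, f⟫_ℂ := by
    intro σ
    have h1 := mem_extPow_iff.1 hg σ
    have h2 : ⟪permOp σ g, permOp σ f⟫_ℂ = ⟪g, f⟫_ℂ := (permOp σ).inner_map_map g f
    rw [h1, inner_smul_left, map_intCast] at h2
    rw [← h2, ← mul_assoc, sign_mul_sign_self, one_mul]
  rw [antisymmetrizer_apply, inner_smul_right, inner_sum]
  simp_rw [inner_smul_right, h, ← mul_assoc, sign_mul_sign_self]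
  have : (p.factorial : ℂ) ≠ 0 := by exact_mod_cast p.factorial_ne_zero
  simp [Fintype.card_perm, this]

theorem permOp_tensorLeft (ξ : Ell2) {p : ℕ} {ψ : TensorPow p} (hψ : ψ ∈ extPow p)
    (e : Equiv.Perm (Fin p)) :
    permOp (Equiv.Perm.decomposeFin.symm (0, e)) (tensorLeft ξ p ψ) =
      ((Equiv.Perm.sign e : ℤ) : ℂ) • tensorLeft ξ p ψ := by
  rw [← map_smul, ← mem_extPow_iff.1 hψ e]
  have h0 : (Equiv.Perm.decomposeFin.symm (0, e)).symm 0 = 0 := by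
    rw [Equiv.symm_apply_eq]; simp
  have h1 : ∀ i, (Equiv.Perm.decomposeFin.symm (0, e)).symm (Fin.succ i) = (e.symm i).succ := by
    intro i; rw [Equiv.symm_apply_eq]; simp
  ext n
  rw [permOp_apply, tensorLeft_apply, tensorLeft_apply, permOp_apply, h0]
  have h2 : (Fin.tail fun i => n ((Equiv.Perm.decomposeFin.symm (0, e)).symm i)) =
      fun i => Fin.tail n (e.symm i) := funext fun i => by simp only [Fin.tail, h1]
  rw [h2]

theorem re_inner_swap_nonneg (ξ : Ell2) {m : ℕ} (ψ : TensorPow (m + 1)) (j : Fin (m + 1)) :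
    0 ≤ RCLike.re ⟪tensorLeft ξ (m + 1) ψ,
      permOp (Equiv.swap 0 j.succ) (tensorLeft ξ (m + 1) ψ)⟫_ℂ := by
  let e1 : ℕ × (Fin (m + 1) → ℕ) ≃ (Fin (m + 2) → ℕ) := Fin.consEquiv (fun _ => ℕ)
  let e2 : ℕ × (Fin m → ℕ) ≃ (Fin (m + 1) → ℕ) := Fin.insertNthEquiv (fun _ => ℕ) j
  let e3 : (Fin m → ℕ) × (ℕ × ℕ) ≃ ℕ × (ℕ × (Fin m → ℕ)) :=
    (Equiv.prodComm _ _).trans (Equiv.prodAssoc _ _ _)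
  let e : (Fin m → ℕ) × (ℕ × ℕ) ≃ (Fin (m + 2) → ℕ) :=
    e3.trans (((Equiv.refl ℕ).prodCongr e2).trans e1)
  let c : (Fin m → ℕ) → ℕ → ℂ := fun n a => ψ (j.insertNth a n) * (starRingEnd ℂ) (ξ a)
  have he : ∀ n a b, e (n, (a, b)) = (Fin.cons a (j.insertNth b n : Fin (m + 1) → ℕ)) := by
    intro n a b; rfl
  have hsw : ∀ n a b, (fun i => e (n, (a, b)) ((Equiv.swap 0 j.succ).symm i)) = e (n, (b, a)) := by
    intro n a b
    rw [he, he]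
    ext i
    refine Fin.cases ?_ (fun k => ?_) i
    · simp
    · by_cases hk : k = j
      · subst hk; simp
      · obtain ⟨l, rfl⟩ := Fin.exists_succAbove_eq hk
        rw [Equiv.symm_swap, Equiv.swap_apply_of_ne_of_ne (Fin.succ_ne_zero _)
          (fun h => hk (Fin.succ_injective _ h))]
        simp
  have hterm : ∀ n a b, ⟪tensorLeft ξ (m + 1) ψ (e (n, (a, b))),
      permOp (Equiv.swap 0 j.succ) (tensorLeft ξ (m + 1) ψ) (e (n, (a, b)))⟫_ℂ =
      c n a * (starRingEnd ℂ) (c n b) := by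
    intro n a b
    rw [permOp_apply, hsw, tensorLeft_apply, tensorLeft_apply, he, he]
    simp only [Fin.cons_zero, Fin.tail_cons, RCLike.inner_apply, map_mul, c, RCLike.conj_conj]
    ring
  have hc : ∀ n, Summable fun a => ‖c n a‖ := by
    intro n
    have hψ : Summable fun a : ℕ => ‖ψ (j.insertNth a n)‖ ^ 2 :=
      (ell2_summable ψ).comp_injective (i := fun a => (j.insertNth a n : Fin (m + 1) → ℕ))
        (fun a b h => by simpa using congrFun h j)
    have := lp.summable_mul (p := 2) (q := 2) (by constructor <;> norm_num)
      (mkL2 (F := fun _ : ℕ => ℂ) (fun a => ψ (j.insertNth a n)) hψ) ξ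
    refine this.congr fun a => ?_
    simp [c, mkL2_apply]
  have hs := lp.hasSum_inner (𝕜 := ℂ) (tensorLeft ξ (m + 1) ψ)
    (permOp (Equiv.swap 0 j.succ) (tensorLeft ξ (m + 1) ψ))
  rw [← e.hasSum_iff] at hs
  have hf := hs.prod_fiberwise (g := fun n => ((‖∑' a, c n a‖ ^ 2 : ℝ) : ℂ)) (by
    intro n
    have h1 : Summable fun b => ‖(starRingEnd ℂ) (c n b)‖ := by simpa using hc n
    have h2 := (summable_mul_of_summable_norm (hc n) h1).hasSum
    rw [← tsum_mul_tsum_of_summable_norm (hc n) h1, ← Complex.conj_tsum, Complex.mul_conj'] at h2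
    push_cast
    refine h2.congr_fun ?_
    rintro ⟨a, b⟩
    exact hterm n a b)
  have hr := Complex.hasSum_re hf
  exact hr.nonneg fun n => by rw [Complex.ofReal_re]; positivity

theorem norm_antisymmetrizer_tensorLeft_le (ξ : Ell2) {p : ℕ} {ψ : TensorPow p}
    (hψ : ψ ∈ extPow p) :
    ‖((Real.sqrt (p + 1) : ℝ) : ℂ) • antisymmetrizer (p + 1) (tensorLeft ξ p ψ)‖ ≤ ‖ξ‖ * ‖ψ‖ := by
  set t := tensorLeft ξ p ψ with ht
  have hmem : antisymmetrizer (p + 1) t ∈ extPow (p + 1) := ⟨t, rfl⟩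
  have h1 : ‖antisymmetrizer (p + 1) t‖ ^ 2 = RCLike.re ⟪t, antisymmetrizer (p + 1) t⟫_ℂ := by
    rw [← inner_self_eq_norm_sq (𝕜 := ℂ), inner_antisymmetrizer hmem, inner_re_symm]
  have hdec : ∀ (q : Fin (p + 1)) (e : Equiv.Perm (Fin p)),
      permOp (Equiv.Perm.decomposeFin.symm (q, e)) t =
        permOp (Equiv.Perm.decomposeFin.symm (0, e)) (permOp (Equiv.swap 0 q) t) := by
    intro q e
    rw [permOp_permOp]
    have : Equiv.Perm.decomposeFin.symm (q, e) =
        Equiv.swap 0 q * Equiv.Perm.decomposeFin.symm (0, e) := by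
      refine Equiv.ext fun i => ?_
      refine Fin.cases ?_ (fun k => ?_) i <;> simp
    rw [this]
  have hinner : ∀ (q : Fin (p + 1)) (e : Equiv.Perm (Fin p)),
      ⟪t, permOp (Equiv.Perm.decomposeFin.symm (q, e)) t⟫_ℂ =
        ((Equiv.Perm.sign e : ℤ) : ℂ) * ⟪t, permOp (Equiv.swap 0 q) t⟫_ℂ := by
    intro q e
    have h2 := (permOp (Equiv.Perm.decomposeFin.symm (0, e))).inner_map_map t
      (permOp (Equiv.swap 0 q) t)
    rw [permOp_tensorLeft ξ hψ, inner_smul_left, map_intCast] at h2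
    rw [hdec, ← h2, ← mul_assoc, sign_mul_sign_self, one_mul]
  have hle : ∀ (q : Fin (p + 1)) (e : Equiv.Perm (Fin p)),
      RCLike.re (((Equiv.Perm.sign (Equiv.Perm.decomposeFin.symm (q, e)) : ℤ) : ℂ) *
        ⟪t, permOp (Equiv.Perm.decomposeFin.symm (q, e)) t⟫_ℂ) ≤ if q = 0 then ‖t‖ ^ 2 else 0 := by
    intro q e
    rw [hinner, Equiv.Perm.decomposeFin.symm_sign]
    split_ifs with hq
    · subst hq
      rw [one_mul, ← mul_assoc, sign_mul_sign_self, one_mul, Equiv.swap_self,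
        ← inner_self_eq_norm_sq (𝕜 := ℂ)]
      exact le_rfl
    · obtain ⟨j, rfl⟩ := Fin.exists_succ_eq_of_ne_zero hq
      cases p with
      | zero => exact j.elim0
      | succ m =>
        have := re_inner_swap_nonneg ξ ψ j
        rw [← ht] at this
        rw [neg_one_mul, Units.val_neg, Int.cast_neg, ← mul_assoc, neg_mul, sign_mul_sign_self,
          neg_one_mul, map_neg]
        linarith
  have h2 : ‖antisymmetrizer (p + 1) t‖ ^ 2 ≤ ((p + 1 : ℕ) : ℝ)⁻¹ * ‖t‖ ^ 2 := by
    rw [h1, antisymmetrizer_apply, inner_smul_right, inner_sum]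
    simp_rw [inner_smul_right]
    rw [← Complex.ofReal_natCast, ← Complex.ofReal_inv, RCLike.re_eq_complex_re,
      Complex.re_ofReal_mul, Complex.re_sum, ← Equiv.sum_comp Equiv.Perm.decomposeFin.symm,
      Fintype.sum_prod_type]
    have h3 : ∑ q : Fin (p + 1), ∑ e : Equiv.Perm (Fin p),
        (((Equiv.Perm.sign (Equiv.Perm.decomposeFin.symm (q, e)) : ℤ) : ℂ) *
          ⟪t, permOp (Equiv.Perm.decomposeFin.symm (q, e)) t⟫_ℂ).re ≤ p.factorial * ‖t‖ ^ 2 := by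
      refine (Finset.sum_le_sum fun q _ => Finset.sum_le_sum fun e _ => hle q e).trans ?_
      simp [Fintype.card_perm]
    refine (mul_le_mul_of_nonneg_left h3 (by positivity)).trans (le_of_eq ?_)
    have : (p.factorial : ℝ) ≠ 0 := by exact_mod_cast p.factorial_ne_zero
    rw [Nat.factorial_succ]
    push_cast
    field_simp
  refine (pow_le_pow_iff_left₀ (norm_nonneg _) (by positivity) two_ne_zero).1 ?_
  rw [norm_smul, mul_pow, Complex.norm_real, Real.norm_of_nonneg (Real.sqrt_nonneg _),
    Real.sq_sqrt (by positivity), ← norm_tensorLeft, ← ht]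
  calc ((p : ℝ) + 1) * ‖antisymmetrizer (p + 1) t‖ ^ 2
      ≤ ((p : ℝ) + 1) * (((p + 1 : ℕ) : ℝ)⁻¹ * ‖t‖ ^ 2) := by gcongr
    _ = ‖t‖ ^ 2 := by push_cast; field_simp

/-- The creation operator on the `p`-particle space,
`ψ ↦ √(p+1) Aₚ₊₁ (ξ ⊗ ψ)`, as a map `⋀ᵖ ℓ² → ⋀ᵖ⁺¹ ℓ²`. -/
noncomputable def creationLevel (ξ : Ell2) (p : ℕ) : extPow p →ₗ[ℂ] extPow (p + 1) :=
  (((Real.sqrt (p + 1) : ℝ) : ℂ) •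
    ((antisymmetrizer (p + 1)).toLinearMap ∘ₗ tensorLeft ξ p ∘ₗ (extPow p).subtype)).codRestrict
    (extPow (p + 1)) (fun ψ => (extPow (p + 1)).smul_mem _ ⟨_, rfl⟩)

theorem coe_creationLevel (ξ : Ell2) (p : ℕ) (ψ : extPow p) :
    (creationLevel ξ p ψ : TensorPow (p + 1)) =
      ((Real.sqrt (p + 1) : ℝ) : ℂ) • antisymmetrizer (p + 1) (tensorLeft ξ p ψ) := rfl

theorem norm_creationLevel_le (ξ : Ell2) (p : ℕ) (ψ : extPow p) :
    ‖creationLevel ξ p ψ‖ ≤ ‖ξ‖ * ‖ψ‖ :=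
  norm_antisymmetrizer_tensorLeft_le ξ ψ.2

/-- The components of `a†(ξ) ψ`. -/
noncomputable def creationFun (ξ : Ell2) (ψ : FermionFock) : (p : ℕ) → extPow p
  | 0 => 0
  | p + 1 => creationLevel ξ p (ψ p)

theorem summable_creationFun (ξ : Ell2) (ψ : FermionFock) :
    Summable (fun p => ‖creationFun ξ ψ p‖ ^ 2) ∧
      ∑' p, ‖creationFun ξ ψ p‖ ^ 2 ≤ (‖ξ‖ * ‖ψ‖) ^ 2 := by
  have h : HasSum (fun p => (‖ξ‖ * ‖ψ p‖) ^ 2) ((‖ξ‖ * ‖ψ‖) ^ 2) := by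
    simp_rw [mul_pow]; exact (ψ.hasSum_norm_sq).mul_left _
  have hle : ∀ p, ‖creationFun ξ ψ (p + 1)‖ ^ 2 ≤ (‖ξ‖ * ‖ψ p‖) ^ 2 := fun p =>
    pow_le_pow_left₀ (norm_nonneg _) (norm_creationLevel_le ξ p (ψ p)) 2
  have hs : Summable (fun p => ‖creationFun ξ ψ (p + 1)‖ ^ 2) :=
    Summable.of_nonneg_of_le (fun _ => sq_nonneg _) hle h.summable
  have hs' := (summable_nat_add_iff (f := fun p => ‖creationFun ξ ψ p‖ ^ 2) 1).1 hs
  refine ⟨hs', ?_⟩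
  rw [hs'.tsum_eq_zero_add, ← h.tsum_eq]
  have h0 : ‖creationFun ξ ψ 0‖ ^ 2 = 0 := by
    change ‖(0 : extPow 0)‖ ^ 2 = 0
    simp
  rw [h0, zero_add]
  exact hs.tsum_le_tsum hle h.summable

/-- The creation operator `a†(ξ)` as a bounded operator on the Fermion Fock space. -/
noncomputable def creation (ξ : Ell2) : FermionFock →L[ℂ] FermionFock :=
  LinearMap.mkContinuous
    { toFun := fun ψ => FermionFock.mk (creationFun ξ ψ) (summable_creationFun ξ ψ).1
      map_add' := fun ψ φ => by
        refine FermionFock.ext fun p => ?_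
        cases p with
        | zero => exact (add_zero (0 : extPow 0)).symm
        | succ p => exact map_add (creationLevel ξ p) (ψ p) (φ p)
      map_smul' := fun c ψ => by
        refine FermionFock.ext fun p => ?_
        cases p with
        | zero => exact (smul_zero (A := extPow 0) c).symm
        | succ p => exact map_smul (creationLevel ξ p) c (ψ p) }
    ‖ξ‖ (fun ψ => by
      refine (pow_le_pow_iff_left₀ (norm_nonneg _) (by positivity) two_ne_zero).1 ?_
      refine le_of_eq_of_le ?_ (summable_creationFun ξ ψ).2
      exact (FermionFock.hasSum_norm_sq (FermionFock.mk (creationFun ξ ψ) (summable_creationFun ξ ψ).1)).tsum_eq.symm)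

theorem creation_apply_zero (ξ : Ell2) (ψ : FermionFock) : creation ξ ψ 0 = 0 := rfl

theorem creation_apply_succ (ξ : Ell2) (ψ : FermionFock) (p : ℕ) :
    (creation ξ ψ (p + 1) : TensorPow (p + 1)) =
      ((Real.sqrt (p + 1) : ℝ) : ℂ) • antisymmetrizer (p + 1) (tensorLeft ξ p (ψ p)) := rfl

/-- The annihilation operator `a(ξ) = a†(ξ)*`. -/
noncomputable def annihilation (ξ : Ell2) : FermionFock →L[ℂ] FermionFock :=
  ContinuousLinearMap.adjoint (creation ξ)

/-- The CAR algebra `CAR(ℓ²)`: the `C*`-algebra of operators on the Fermion Fock space generated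
by the annihilation operators. -/
noncomputable def carAlgebra : StarSubalgebra ℂ (FermionFock →L[ℂ] FermionFock) :=
  (StarAlgebra.adjoin ℂ (Set.range annihilation)).topologicalClosure

end Fock

section SecondQuantization

theorem ell2Basis_apply (k : ℕ) : ell2Basis k = lp.single 2 k (1 : ℂ) := by
  rw [← HilbertBasis.repr_symm_single]; rfl

theorem ell2_inner_basis (m : ℕ) (v : Ell2) : ⟪ell2Basis m, v⟫_ℂ = v m := by
  rw [← HilbertBasis.repr_apply_apply]; rfl

theorem orthonormal_elemTensor {p : ℕ} (u : unitary (Ell2 →L[ℂ] Ell2)) :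
    Orthonormal ℂ fun n : Fin p → ℕ =>
      elemTensor fun i => (u : Ell2 →L[ℂ] Ell2) (ell2Basis (n i)) := by
  classical
  rw [orthonormal_iff_ite]
  intro n m
  have h : ∀ a b : ℕ, ⟪(u : Ell2 →L[ℂ] Ell2) (ell2Basis a), (u : Ell2 →L[ℂ] Ell2) (ell2Basis b)⟫_ℂ =
      if a = b then 1 else 0 := by
    intro a b
    rw [← ContinuousLinearMap.adjoint_inner_right, ← ContinuousLinearMap.star_eq_adjoint,
      ← mul_apply_eq_comp, Unitary.star_mul_self_of_mem u.2]
    exact orthonormal_iff_ite.1 ell2Basis.orthonormal a b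
  rw [inner_elemTensor]
  simp_rw [h]
  split_ifs with hnm
  · subst hnm; simp
  · obtain ⟨i, hi⟩ := Function.ne_iff.1 hnm
    exact Finset.prod_eq_zero (Finset.mem_univ i) (if_neg hi)

/-- The operator `⊗ᵖ u` on `⊗ᵖ ℓ²`: the isometry that sends `e_{n₁} ⊗ ⋯ ⊗ e_{nₚ}` to
`u e_{n₁} ⊗ ⋯ ⊗ u e_{nₚ}`.  See `tensorMap_elemTensor` for general elementary tensors. -/
noncomputable def tensorMap (u : unitary (Ell2 →L[ℂ] Ell2)) (p : ℕ) :
    TensorPow p →ₗᵢ[ℂ] TensorPow p :=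
  (orthonormal_elemTensor (p := p) u).orthogonalFamily.linearIsometry

theorem tensorMap_elemTensor (u : unitary (Ell2 →L[ℂ] Ell2)) {p : ℕ} (ξ : Fin p → Ell2) :
    tensorMap u p (elemTensor ξ) = elemTensor fun i => (u : Ell2 →L[ℂ] Ell2) (ξ i) := by
  ext m
  have h1 := (orthonormal_elemTensor (p := p) u).orthogonalFamily.hasSum_linearIsometry
    (elemTensor ξ)
  have h2 : HasSum (fun n : Fin p → ℕ => (∏ i, ξ i (n i)) *
      ∏ i, (u : Ell2 →L[ℂ] Ell2) (ell2Basis (n i)) (m i)) (tensorMap u p (elemTensor ξ) m) :=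
    h1.mapL (lp.evalCLM ℂ (fun _ : Fin p → ℕ => ℂ) 2 m)
  have h3 : ∀ i, HasSum (fun k => ξ i k * (u : Ell2 →L[ℂ] Ell2) (ell2Basis k) (m i))
      ((u : Ell2 →L[ℂ] Ell2) (ξ i) (m i)) := by
    intro i
    have := ((ell2Basis.hasSum_repr (ξ i)).mapL (u : Ell2 →L[ℂ] Ell2)).mapL
      (lp.evalCLM ℂ (fun _ : ℕ => ℂ) 2 (m i))
    refine this.congr_fun fun k => ?_
    rw [map_smul, map_smul]
    rfl
  have h4 : ∀ i, Summable fun k => ‖ξ i k * (u : Ell2 →L[ℂ] Ell2) (ell2Basis k) (m i)‖ := by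
    intro i
    have := lp.summable_mul (p := 2) (q := 2) (by constructor <;> norm_num) (ξ i)
      (ContinuousLinearMap.adjoint (u : Ell2 →L[ℂ] Ell2) (ell2Basis (m i)))
    refine this.congr fun k => ?_
    rw [← ell2_inner_basis (m i), ← ContinuousLinearMap.adjoint_inner_left, ← inner_conj_symm,
      ell2_inner_basis, norm_mul, RCLike.norm_conj]
  have h5 := (summable_and_tsum_prod p
    (fun i k => ξ i k * (u : Ell2 →L[ℂ] Ell2) (ell2Basis k) (m i)) h4).2
  rw [elemTensor_apply, ← h2.tsum_eq]
  simp_rw [← Finset.prod_mul_distrib]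
  rw [h5]
  exact Finset.prod_congr rfl fun i _ => (h3 i).tsum_eq

theorem single_eq_elemTensor {p : ℕ} (n : Fin p → ℕ) :
    (lp.single 2 n (1 : ℂ) : TensorPow p) = elemTensor fun i => ell2Basis (n i) := by
  ext m
  rw [elemTensor_apply]
  simp_rw [ell2Basis_apply, lp.single_apply]
  by_cases h : m = n
  · subst h; simp
  · obtain ⟨i, hi⟩ := Function.ne_iff.1 h
    rw [Finset.prod_eq_zero (Finset.mem_univ i) (by simp [hi])]
    simp [h]

theorem permOp_tensorMap (u : unitary (Ell2 →L[ℂ] Ell2)) {p : ℕ} (σ : Equiv.Perm (Fin p))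
    (f : TensorPow p) : permOp σ (tensorMap u p f) = tensorMap u p (permOp σ f) := by
  have h : (permOp σ).toContinuousLinearMap ∘L (tensorMap u p).toContinuousLinearMap =
      (tensorMap u p).toContinuousLinearMap ∘L (permOp σ).toContinuousLinearMap := by
    refine lp.ext_continuousLinearMap (by norm_num) fun n => ?_
    ext1
    change permOp σ (tensorMap u p (lp.single 2 n (1 : ℂ))) =
      tensorMap u p (permOp σ (lp.single 2 n (1 : ℂ)))
    rw [single_eq_elemTensor, tensorMap_elemTensor, permOp_elemTensor, permOp_elemTensor,
      tensorMap_elemTensor]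
  exact congrArg (fun T : TensorPow p →L[ℂ] TensorPow p => T f) h

theorem tensorMap_mem_extPow (u : unitary (Ell2 →L[ℂ] Ell2)) {p : ℕ} {f : TensorPow p}
    (hf : f ∈ extPow p) : tensorMap u p f ∈ extPow p := by
  rw [mem_extPow_iff] at hf ⊢
  intro σ
  rw [permOp_tensorMap, hf, map_smul]

/-- The part `⋀ᵖ u` of `⊗ᵖ u` in `⋀ᵖ ℓ²`. -/
noncomputable def extMap (u : unitary (Ell2 →L[ℂ] Ell2)) (p : ℕ) : extPow p →ₗᵢ[ℂ] extPow p where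
  toLinearMap := (tensorMap u p).toLinearMap.restrict fun _ hf => tensorMap_mem_extPow u hf
  norm_map' f := (tensorMap u p).norm_map f

theorem coe_extMap (u : unitary (Ell2 →L[ℂ] Ell2)) (p : ℕ) (f : extPow p) :
    (extMap u p f : TensorPow p) = tensorMap u p f := rfl

/-- The second quantization `Γ(u) = ⨁ₚ ⋀ᵖ u`. -/
noncomputable def secondQuantization (u : unitary (Ell2 →L[ℂ] Ell2)) :
    FermionFock →L[ℂ] FermionFock :=
  LinearMap.mkContinuous
    { toFun := fun ψ => FermionFock.mk (fun p => extMap u p (ψ p))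
        ((ψ.hasSum_norm_sq).summable.congr fun p => by rw [LinearIsometry.norm_map])
      map_add' := fun ψ φ => FermionFock.ext fun p => map_add (extMap u p) (ψ p) (φ p)
      map_smul' := fun c ψ => FermionFock.ext fun p => map_smul (extMap u p) c (ψ p) }
    1 (fun ψ => by
      rw [one_mul]
      refine le_of_eq ((pow_left_inj₀ (norm_nonneg _) (norm_nonneg _) two_ne_zero).1 ?_)
      refine (FermionFock.hasSum_norm_sq _).unique ((ψ.hasSum_norm_sq).congr_fun fun p => ?_)
      exact congrArg (· ^ 2) ((extMap u p).norm_map (ψ p)))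

theorem secondQuantization_apply (u : unitary (Ell2 →L[ℂ] Ell2)) (ψ : FermionFock) (p : ℕ) :
    secondQuantization u ψ p = extMap u p (ψ p) := rfl

end SecondQuantization

/-- A topological group `G` is norm unitarily representable (NUR): it is Hausdorff and isomorphic as
a topological group to a norm-closed subgroup of the unitary group of some complex Hilbert space. -/
def IsNUR.{v} (G : Type v) [Group G] [TopologicalSpace G] : Prop :=
  IsTopologicalGroup G ∧ T2Space G ∧
    ∃ (K : Type v) (_ : NormedAddCommGroup K) (_ : InnerProductSpace ℂ K) (_ : CompleteSpace K)
      (S : Subgroup (unitary (K →L[ℂ] K))),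
      IsClosed (S : Set (unitary (K →L[ℂ] K))) ∧ Nonempty (G ≃ₜ* S)

end CARFock

/-! Vectors `wedge η` are total in Fock space and have Gram determinants as inner products, so every
operator identity reduces to a determinant identity. In particular the CAR hold and `Γ(1 + c|f⟩⟨f|)
= 1 + c a†(f) a(f)`. For `‖f‖ ≤ 1` this operator lies in the CAR algebra at distance at most `|c|`
from `1`.

Upper bound (`secondQuantization_mem_and_norm_le`). For `u` in `𝒰₁` the operator `u - 1` is compact
and normal, so it has an eigenvalue `c` with `|c| = ‖u - 1‖`. Dividing `u` by the corresponding
rank-one perturbation of `1` lowers `‖u - 1‖₁` by exactly `|c|` (`exists_peel`). Iteration writes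
`u` as an infinite product of such factors, the sum of the `|c|` being at most `‖u - 1‖₁`. Hence the
partial products of the `Γ`'s converge in norm, `Γ(u)` lies in the CAR algebra, and `‖Γ(u) - 1‖ ≤ ‖u
- 1‖₁`.

Lower bound (`eTraceNorm_sub_one_le`). If `‖Γ(u) - 1‖ ≤ δ ≤ 1/10`, every determinant `det ⟪ξ i, u ξ
j⟫` over an orthonormal family is within `δ` of `1`. When the family diagonalizes the compression of
`h = (u - u*)/2i` with nonnegative eigenvalues, adjoining one vector turns the argument of the
determinant by an amount comparable to the new eigenvalue. The arguments remain small, so the sum of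
the eigenvalues is `O(δ)`. Applying this to `u` and to `u*` bounds `‖h‖₁`, and near `1` the trace
norm of `u - 1` is controlled by that of `h`, so `‖u - 1‖₁ ≤ 14 δ`.

Both metrics are left invariant, so the two bounds show that `Γ` is an embedding. The range is
closed because `Γ` dominates the operator norm on the one-particle space, and the lower bound puts
the limit back into `𝒰₁`. -/

namespace CARFock

/-! ### Exterior products, the CAR, and second quantization of rank-one perturbations of `1`. -/

section Wedge

noncomputable instance : Inner ℂ FermionFock := InnerProductSpace.toInner

theorem antisymmetrizer_permOp {p : ℕ} (σ : Equiv.Perm (Fin p)) (f : TensorPow p) :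
    antisymmetrizer p (permOp σ f) = ((Equiv.Perm.sign σ : ℤ) : ℂ) • antisymmetrizer p f := by
  rw [antisymmetrizer_apply, antisymmetrizer_apply, smul_comm ((Equiv.Perm.sign σ : ℤ) : ℂ),
    Finset.smul_sum (r := ((Equiv.Perm.sign σ : ℤ) : ℂ)),
    ← Equiv.sum_comp (Equiv.mulLeft σ) (fun τ => ((Equiv.Perm.sign σ : ℤ) : ℂ) •
      ((Equiv.Perm.sign τ : ℤ) : ℂ) • permOp τ f)]
  congr 1
  refine Finset.sum_congr rfl fun τ _ => ?_
  rw [permOp_permOp, smul_smul]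
  congr 1
  simp only [Equiv.coe_mulLeft, Equiv.Perm.sign_mul, Units.val_mul, Int.cast_mul]
  rw [← mul_assoc, sign_mul_sign_self, one_mul]

/-- A permutation of the last `p` factors is a permutation of all `p + 1` with the same sign, so the
outer antisymmetrizer absorbs it and the `p!` terms of the inner one coincide. -/
theorem antisymmetrizer_tensorLeft_antisymmetrizer (ξ : Ell2) {p : ℕ} (η : Fin p → Ell2) :
    antisymmetrizer (p + 1) (tensorLeft ξ p (antisymmetrizer p (elemTensor η))) =
      antisymmetrizer (p + 1) (elemTensor (Fin.cons ξ η : Fin (p + 1) → Ell2)) := by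
  have hσ : ∀ σ : Equiv.Perm (Fin p), tensorLeft ξ p (permOp σ (elemTensor η)) =
      permOp (Equiv.Perm.decomposeFin.symm (0, σ))
        (elemTensor (Fin.cons ξ η : Fin (p + 1) → Ell2)) := by
    intro σ
    rw [permOp_elemTensor, permOp_elemTensor, tensorLeft_elemTensor]
    congr 1
    funext i
    refine Fin.cases ?_ (fun k => ?_) i <;> simp
  rw [antisymmetrizer_apply (elemTensor η), map_smul, map_sum, map_smul, map_sum]
  simp_rw [map_smul, hσ, antisymmetrizer_permOp, Equiv.Perm.decomposeFin.symm_sign, if_pos,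
    one_mul, smul_smul, sign_mul_sign_self]
  have : (p.factorial : ℂ) ≠ 0 := by exact_mod_cast p.factorial_ne_zero
  simp only [one_smul, Finset.sum_const, Finset.card_univ, Fintype.card_perm, Fintype.card_fin,
    ← Nat.cast_smul_eq_nsmul ℂ, smul_smul, inv_mul_cancel₀ this]

/-- The vector of the Fock space with the single nonzero component `x ∈ ⋀ᵖ ℓ²`. -/
noncomputable def FermionFock.single (p : ℕ) (x : extPow p) : FermionFock :=
  (lp.single 2 p x : lp (fun p : ℕ => extPow p) 2)

theorem FermionFock.single_same (p : ℕ) (x : extPow p) : FermionFock.single p x p = x :=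
  lp.single_apply_self (E := fun p : ℕ => extPow p) 2 p x

theorem FermionFock.single_of_ne {p q : ℕ} (h : q ≠ p) (x : extPow p) :
    FermionFock.single p x q = 0 :=
  lp.single_apply_ne (E := fun p : ℕ => extPow p) 2 p x h

theorem FermionFock.inner_single_left (p : ℕ) (x : extPow p) (ψ : FermionFock) :
    ⟪FermionFock.single p x, ψ⟫_ℂ = ⟪x, ψ p⟫_ℂ :=
  lp.inner_single_left (𝕜 := ℂ) (G := fun p : ℕ => extPow p) p x ψ

/-- The normalized exterior product `√p! Aₚ (η₁ ⊗ ⋯ ⊗ ηₚ)` as a vector of `⋀ᵖ ℓ²`. -/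
noncomputable def extVec {p : ℕ} (η : Fin p → Ell2) : extPow p :=
  ⟨((Real.sqrt p.factorial : ℝ) : ℂ) • antisymmetrizer p (elemTensor η),
    (extPow p).smul_mem _ ⟨_, rfl⟩⟩

/-- The normalized exterior product `√p! Aₚ (η₁ ⊗ ⋯ ⊗ ηₚ)` as a vector of the Fock space. -/
noncomputable def wedge {p : ℕ} (η : Fin p → Ell2) : FermionFock :=
  FermionFock.single p (extVec η)

theorem sqrt_factorial_mul_self (p : ℕ) :
    ((Real.sqrt p.factorial : ℝ) : ℂ) * ((Real.sqrt p.factorial : ℝ) : ℂ) = p.factorial := by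
  rw [← Complex.ofReal_mul, Real.mul_self_sqrt (by positivity)]; simp

/-- One antisymmetrizer is absorbed by the other, and its `1/p!` cancels the two factors `√p!`. What
remains is the Leibniz formula. -/
theorem inner_extVec {p : ℕ} (ξ η : Fin p → Ell2) :
    ⟪extVec ξ, extVec η⟫_ℂ = (Matrix.of fun i j => ⟪ξ i, η j⟫_ℂ).det := by
  change ⟪((Real.sqrt p.factorial : ℝ) : ℂ) • antisymmetrizer p (elemTensor ξ),
    ((Real.sqrt p.factorial : ℝ) : ℂ) • antisymmetrizer p (elemTensor η)⟫_ℂ = _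
  rw [inner_smul_left, inner_smul_right, Complex.conj_ofReal, ← mul_assoc, sqrt_factorial_mul_self,
    inner_antisymmetrizer (g := antisymmetrizer p (elemTensor ξ)) ⟨_, rfl⟩, antisymmetrizer_apply,
    inner_smul_left, sum_inner, Matrix.det_apply']
  have : (p.factorial : ℂ) ≠ 0 := by exact_mod_cast p.factorial_ne_zero
  rw [map_inv₀, map_natCast, ← mul_assoc, mul_inv_cancel₀ this, one_mul]
  refine Finset.sum_congr rfl fun σ _ => ?_
  rw [inner_smul_left, permOp_elemTensor, inner_elemTensor, map_intCast]
  rfl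

theorem inner_wedge {p : ℕ} (ξ η : Fin p → Ell2) :
    ⟪wedge ξ, wedge η⟫_ℂ = (Matrix.of fun i j => ⟪ξ i, η j⟫_ℂ).det := by
  rw [wedge, FermionFock.inner_single_left, wedge, FermionFock.single_same, inner_extVec]

theorem inner_wedge_of_ne {p q : ℕ} (h : p ≠ q) (ξ : Fin p → Ell2) (η : Fin q → Ell2) :
    ⟪wedge ξ, wedge η⟫_ℂ = 0 := by
  rw [wedge, FermionFock.inner_single_left, wedge, FermionFock.single_of_ne h, inner_zero_right]

/-- The normalizations match because `√(p+1) · √p! = √(p+1)!`. -/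
theorem creation_wedge (ξ : Ell2) {p : ℕ} (η : Fin p → Ell2) :
    creation ξ (wedge η) = wedge (Fin.cons ξ η : Fin (p + 1) → Ell2) := by
  refine FermionFock.ext fun q => ?_
  cases q with
  | zero => exact (FermionFock.single_of_ne (Nat.succ_ne_zero p).symm _).symm
  | succ q =>
    change creationLevel ξ q (FermionFock.single p (extVec η) q) =
      FermionFock.single (p + 1) (extVec _) (q + 1)
    by_cases h : q = p
    · subst h
      rw [FermionFock.single_same, FermionFock.single_same]
      refine Subtype.ext ?_
      rw [coe_creationLevel]
      change _ • antisymmetrizer (q + 1) (tensorLeft ξ q (_ • antisymmetrizer q (elemTensor η))) =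
        _ • antisymmetrizer (q + 1) (elemTensor _)
      rw [map_smul, map_smul, smul_smul, antisymmetrizer_tensorLeft_antisymmetrizer,
        Nat.factorial_succ, Nat.cast_mul, Real.sqrt_mul (by positivity), Complex.ofReal_mul]
      push_cast
      rfl
    · rw [FermionFock.single_of_ne h, FermionFock.single_of_ne (by omega), map_zero]

theorem tensorMap_antisymmetrizer (u : unitary (Ell2 →L[ℂ] Ell2)) {p : ℕ} (f : TensorPow p) :
    tensorMap u p (antisymmetrizer p f) = antisymmetrizer p (tensorMap u p f) := by
  rw [antisymmetrizer_apply, antisymmetrizer_apply, map_smul, map_sum]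
  simp_rw [map_smul, permOp_tensorMap]

theorem secondQuantization_wedge (u : unitary (Ell2 →L[ℂ] Ell2)) {p : ℕ} (η : Fin p → Ell2) :
    secondQuantization u (wedge η) = wedge fun i => (u : Ell2 →L[ℂ] Ell2) (η i) := by
  refine FermionFock.ext fun q => ?_
  rw [secondQuantization_apply, wedge, wedge]
  by_cases h : q = p
  · subst h
    rw [FermionFock.single_same, FermionFock.single_same]
    refine Subtype.ext ?_
    rw [coe_extMap]
    change tensorMap u q (_ • antisymmetrizer q (elemTensor η)) = _ • antisymmetrizer q (elemTensor _)
    rw [map_smul, tensorMap_antisymmetrizer, tensorMap_elemTensor]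
  · rw [FermionFock.single_of_ne h, FermionFock.single_of_ne h, map_zero]

/-- Pairing with the wedge of the basis vectors `e_{n i}` reads off the coordinate `n` of the
`p`-particle component, up to the nonzero factor `√p!`. -/
theorem ext_inner_wedge {ψ φ : FermionFock}
    (h : ∀ (p : ℕ) (η : Fin p → Ell2), ⟪wedge η, ψ⟫_ℂ = ⟪wedge η, φ⟫_ℂ) : ψ = φ := by
  refine FermionFock.ext fun p => Subtype.ext ?_
  ext n
  have h1 : ∀ χ : FermionFock, ⟪wedge fun i => ell2Basis (n i), χ⟫_ℂ =
      ((Real.sqrt p.factorial : ℝ) : ℂ) * (χ p : TensorPow p) n := by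
    intro χ
    rw [wedge, FermionFock.inner_single_left]
    change ⟪((Real.sqrt p.factorial : ℝ) : ℂ) • antisymmetrizer p (elemTensor _),
      (χ p : TensorPow p)⟫_ℂ = _
    rw [inner_smul_left, Complex.conj_ofReal, ← inner_conj_symm,
      inner_antisymmetrizer (χ p).2, inner_conj_symm, ← single_eq_elemTensor,
      lp.inner_single_left]
    simp
  have h2 := h p fun i => ell2Basis (n i)
  rw [h1, h1] at h2
  refine mul_left_cancel₀ ?_ h2
  exact_mod_cast (Real.sqrt_pos.2 (by exact_mod_cast p.factorial_pos)).ne'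

/-- Passing to adjoints turns agreement on wedges into agreement of inner products against wedges,
so no density argument is needed. -/
theorem clm_ext_wedge {S T : FermionFock →L[ℂ] FermionFock}
    (h : ∀ (p : ℕ) (η : Fin p → Ell2), S (wedge η) = T (wedge η)) : S = T := by
  have h1 : ContinuousLinearMap.adjoint S = ContinuousLinearMap.adjoint T := by
    ext1 ψ
    refine ext_inner_wedge fun p η => ?_
    rw [ContinuousLinearMap.adjoint_inner_right, ContinuousLinearMap.adjoint_inner_right, h]
  simpa using congrArg ContinuousLinearMap.adjoint h1

/-- Paired with a wedge, this is the Laplace expansion of a Gram determinant along the row of `f`.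
-/
theorem annihilation_wedge (f : Ell2) {p : ℕ} (η : Fin (p + 1) → Ell2) :
    annihilation f (wedge η) =
      ∑ j : Fin (p + 1), ((-1) ^ (j : ℕ) * ⟪f, η j⟫_ℂ) • wedge (fun i => η (j.succAbove i)) := by
  refine ext_inner_wedge fun q ζ => ?_
  rw [annihilation, ContinuousLinearMap.adjoint_inner_right, creation_wedge, inner_sum]
  simp_rw [inner_smul_right]
  by_cases h : q = p
  · subst h
    rw [inner_wedge, Matrix.det_succ_row_zero]
    refine Finset.sum_congr rfl fun j _ => ?_
    rw [inner_wedge]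
    rfl
  · rw [inner_wedge_of_ne (by omega)]
    refine (Finset.sum_eq_zero fun j _ => ?_).symm
    rw [inner_wedge_of_ne h, mul_zero]

theorem annihilation_wedge_zero (f : Ell2) (η : Fin 0 → Ell2) : annihilation f (wedge η) = 0 := by
  refine ext_inner_wedge fun q ζ => ?_
  rw [annihilation, ContinuousLinearMap.adjoint_inner_right, creation_wedge,
    inner_wedge_of_ne (by omega), inner_zero_right]

/-- The canonical anticommutation relation between annihilation and creation operators. -/
theorem annihilation_mul_creation (f ξ : Ell2) :
    annihilation f * creation ξ + creation ξ * annihilation f = ⟪f, ξ⟫_ℂ • 1 := by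
  refine clm_ext_wedge fun p η => ?_
  change annihilation f (creation ξ (wedge η)) + creation ξ (annihilation f (wedge η)) =
    ⟪f, ξ⟫_ℂ • wedge η
  -- The term that removes `ξ` is the right-hand side. Each term that removes some `η j` sits one
  -- place further than in the second product, so its sign is opposite and it cancels.
  rw [creation_wedge, annihilation_wedge, Fin.sum_univ_succ]
  have h0 : (fun i => (Fin.cons ξ η : Fin (p + 1) → Ell2) ((0 : Fin (p + 1)).succAbove i)) = η := by
    funext i; simp
  rw [h0]
  cases p with
  | zero => simp [annihilation_wedge_zero]
  | succ p =>
    rw [annihilation_wedge, map_sum]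
    have h1 : ∀ j : Fin (p + 1), (fun i => (Fin.cons ξ η : Fin (p + 2) → Ell2) (j.succ.succAbove i)) =
        (Fin.cons ξ fun i => η (j.succAbove i) : Fin (p + 1) → Ell2) := by
      intro j; funext i
      refine Fin.cases ?_ (fun k => ?_) i <;> simp
    simp_rw [map_smul, creation_wedge, h1]
    simp [pow_succ]

/-- The Gram matrix against any wedge has two equal columns. -/
theorem creation_mul_self (ξ : Ell2) : creation ξ * creation ξ = 0 := by
  refine clm_ext_wedge fun p η => ext_inner_wedge fun q ζ => ?_
  rw [mul_apply_eq_comp, creation_wedge, creation_wedge, zero_apply, inner_zero_right]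
  by_cases h : q = p + 2
  · subst h
    rw [inner_wedge]
    refine Matrix.det_zero_of_column_eq (i := 0) (j := 1) (by simp) fun k => ?_
    simp only [Matrix.of_apply]
    rfl
  · exact inner_wedge_of_ne h _ _

theorem creation_add (ξ η : Ell2) : creation (ξ + η) = creation ξ + creation η := by
  refine clm_ext_wedge fun p ζ => ext_inner_wedge fun q θ => ?_
  rw [add_apply, inner_add_right, creation_wedge, creation_wedge, creation_wedge]
  by_cases h : q = p + 1
  · subst h
    simp_rw [inner_wedge, Matrix.det_succ_column_zero, ← Finset.sum_add_distrib]
    refine Finset.sum_congr rfl fun i _ => ?_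
    simp only [Matrix.of_apply, Fin.cons_zero, inner_add_right, mul_add, add_mul]
    rfl
  · simp [inner_wedge_of_ne h]

theorem creation_smul (c : ℂ) (ξ : Ell2) : creation (c • ξ) = c • creation ξ := by
  refine clm_ext_wedge fun p ζ => ext_inner_wedge fun q θ => ?_
  rw [smul_apply, inner_smul_right, creation_wedge, creation_wedge]
  by_cases h : q = p + 1
  · subst h
    simp_rw [inner_wedge, Matrix.det_succ_column_zero, Finset.mul_sum]
    refine Finset.sum_congr rfl fun i _ => ?_
    simp only [Matrix.of_apply, Fin.cons_zero, inner_smul_right]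
    rw [show ∀ a b d e : ℂ, a * (b * d) * e = b * (a * d * e) by intros; ring]
    rfl
  · simp [inner_wedge_of_ne h]

theorem creation_mul_creation (ξ η : Ell2) :
    creation ξ * creation η = -(creation η * creation ξ) := by
  have h := creation_mul_self (ξ + η)
  rw [creation_add, add_mul, mul_add, mul_add, creation_mul_self, creation_mul_self, zero_add,
    add_zero] at h
  exact eq_neg_of_add_eq_zero_left h

theorem norm_creation_le (ξ : Ell2) : ‖creation ξ‖ ≤ ‖ξ‖ :=
  LinearMap.mkContinuous_norm_le _ (norm_nonneg _) _

theorem annihilation_mem (ξ : Ell2) : annihilation ξ ∈ carAlgebra :=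
  StarSubalgebra.le_topologicalClosure _ (StarAlgebra.subset_adjoin ℂ _ ⟨ξ, rfl⟩)

theorem star_annihilation (ξ : Ell2) : star (annihilation ξ) = creation ξ := by
  rw [annihilation, ← ContinuousLinearMap.star_eq_adjoint, star_star]

theorem creation_mem (ξ : Ell2) : creation ξ ∈ carAlgebra := by
  rw [← star_annihilation]; exact star_mem (annihilation_mem ξ)

theorem wedge_cons_tail {p : ℕ} (η : Fin (p + 1) → Ell2) :
    wedge η = creation (η 0) (wedge (Fin.tail η)) := by
  rw [creation_wedge, Fin.cons_self_tail]

/-- If `u = 1 + c |f⟩⟨f|`, then `Γ(u) = 1 + c a†(f) a(f)`. -/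
theorem secondQuantization_of_rankOne (u : unitary (Ell2 →L[ℂ] Ell2)) (f : Ell2) (c : ℂ)
    (h : ∀ v, (u : Ell2 →L[ℂ] Ell2) v = v + (c * ⟪f, v⟫_ℂ) • f) :
    secondQuantization u = 1 + c • (creation f * annihilation f) := by
  refine clm_ext_wedge fun p => ?_
  induction p with
  | zero =>
    intro η
    have : (fun i => (u : Ell2 →L[ℂ] Ell2) (η i)) = η := Subsingleton.elim _ _
    rw [secondQuantization_wedge, this]
    simp [annihilation_wedge_zero]
  | succ p ih =>
    intro η
    -- `Γ(u)` intertwines `a†(η)` with `a†(u η)`. The candidate does too, by the CAR and `a†(f)² =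
    -- 0`. Both fix the vacuum sector, so induction on the number of factors applies.
    have key : (1 + c • (creation f * annihilation f)) * creation (η 0) =
        creation ((u : Ell2 →L[ℂ] Ell2) (η 0)) * (1 + c • (creation f * annihilation f)) := by
      have h1 : annihilation f * creation (η 0) =
          ⟪f, η 0⟫_ℂ • 1 - creation (η 0) * annihilation f :=
        eq_sub_of_add_eq (annihilation_mul_creation f (η 0))
      have h2 : creation f * annihilation f * creation (η 0) =
          ⟪f, η 0⟫_ℂ • creation f + creation (η 0) * (creation f * annihilation f) := by
        rw [mul_assoc, h1, mul_sub, mul_smul_comm, mul_one, ← mul_assoc, creation_mul_creation f,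
          neg_mul, sub_neg_eq_add, mul_assoc]
      have h3 : creation f * (creation f * annihilation f) = 0 := by
        rw [← mul_assoc, creation_mul_self, zero_mul]
      rw [h, creation_add, creation_smul, add_mul, one_mul, smul_mul_assoc, h2, add_mul, mul_add,
        mul_add, mul_one, mul_one, mul_smul_comm, smul_mul_assoc, mul_smul_comm, h3, smul_zero,
        smul_zero, add_zero, smul_add, smul_smul]
      abel
    rw [wedge_cons_tail η, ← mul_apply_eq_comp, ← mul_apply_eq_comp, key,
      mul_apply_eq_comp _ (1 + _), ← ih, mul_apply_eq_comp, secondQuantization_wedge,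
      creation_wedge, creation_wedge, secondQuantization_wedge]
    congr 1
    funext i
    refine Fin.cases ?_ (fun k => ?_) i <;> simp

end Wedge

/-! ### `Γ` as a homomorphism, its one-particle part, and its diagonal matrix coefficients. -/

section SecondQuantizationHom

open Filter Topology

theorem secondQuantization_one : secondQuantization 1 = 1 :=
  clm_ext_wedge fun p η => by rw [secondQuantization_wedge]; rfl

theorem secondQuantization_mul (u v : unitary (Ell2 →L[ℂ] Ell2)) :
    secondQuantization (u * v) = secondQuantization u * secondQuantization v :=
  clm_ext_wedge fun p η => by
    rw [mul_apply_eq_comp, secondQuantization_wedge, secondQuantization_wedge,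
      secondQuantization_wedge]
    rfl

theorem inner_wedge_secondQuantization (u : unitary (Ell2 →L[ℂ] Ell2)) {p : ℕ}
    (ζ η : Fin p → Ell2) : ⟪wedge ζ, secondQuantization u (wedge η)⟫_ℂ =
      (Matrix.of fun i j => ⟪ζ i, (u : Ell2 →L[ℂ] Ell2) (η j)⟫_ℂ).det := by
  rw [secondQuantization_wedge, inner_wedge]

theorem star_secondQuantization (u : unitary (Ell2 →L[ℂ] Ell2)) :
    star (secondQuantization u) = secondQuantization u⁻¹ := by
  refine clm_ext_wedge fun q η => ext_inner_wedge fun p ζ => ?_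
  rw [ContinuousLinearMap.star_eq_adjoint, ContinuousLinearMap.adjoint_inner_right,
    secondQuantization_wedge, secondQuantization_wedge]
  by_cases hpq : p = q
  · subst hpq
    rw [inner_wedge, inner_wedge]
    congr 2
    funext i j
    rw [← Unitary.star_eq_inv, Unitary.coe_star, ContinuousLinearMap.star_eq_adjoint,
      ContinuousLinearMap.adjoint_inner_right]
  · rw [inner_wedge_of_ne hpq, inner_wedge_of_ne hpq]

theorem secondQuantization_mem_unitary (u : unitary (Ell2 →L[ℂ] Ell2)) :
    secondQuantization u ∈ unitary (FermionFock →L[ℂ] FermionFock) := by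
  rw [Unitary.mem_iff, star_secondQuantization, ← secondQuantization_mul,
    ← secondQuantization_mul, inv_mul_cancel, mul_inv_cancel, secondQuantization_one]
  exact ⟨rfl, rfl⟩

/-- Second quantization as a homomorphism of unitary groups. -/
noncomputable def secondQuantizationHom :
    unitary (Ell2 →L[ℂ] Ell2) →* unitary (FermionFock →L[ℂ] FermionFock) where
  toFun u := ⟨secondQuantization u, secondQuantization_mem_unitary u⟩
  map_one' := Subtype.ext secondQuantization_one
  map_mul' u v := Subtype.ext (secondQuantization_mul u v)

theorem coe_secondQuantizationHom (u : unitary (Ell2 →L[ℂ] Ell2)) :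
    (secondQuantizationHom u : FermionFock →L[ℂ] FermionFock) = secondQuantization u := rfl

theorem norm_secondQuantization_sub (u v : unitary (Ell2 →L[ℂ] Ell2)) :
    ‖secondQuantization u - secondQuantization v‖ = ‖secondQuantization (v⁻¹ * u) - 1‖ := by
  have : secondQuantization u - secondQuantization v =
      (secondQuantizationHom v : FermionFock →L[ℂ] FermionFock) *
        (secondQuantization (v⁻¹ * u) - 1) := by
    rw [coe_secondQuantizationHom, mul_sub, ← secondQuantization_mul, mul_one, mul_inv_cancel_left]
  rw [this, CStarRing.norm_coe_unitary_mul]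

theorem norm_wedge_one (ξ : Ell2) : ‖wedge fun _ : Fin 1 => ξ‖ = ‖ξ‖ := by
  have h : ⟪wedge fun _ : Fin 1 => ξ, wedge fun _ : Fin 1 => ξ⟫_ℂ = ⟪ξ, ξ⟫_ℂ := by
    rw [inner_wedge, Matrix.det_fin_one]
    rfl
  rw [inner_self_eq_norm_sq_to_K, inner_self_eq_norm_sq_to_K] at h
  exact (pow_left_inj₀ (norm_nonneg _) (norm_nonneg _) two_ne_zero).1 (by exact_mod_cast h)

theorem wedge_one_sub (ξ η : Ell2) : (wedge fun _ : Fin 1 => ξ) - (wedge fun _ : Fin 1 => η) =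
    wedge fun _ : Fin 1 => ξ - η := by
  rw [wedge_cons_tail, wedge_cons_tail (fun _ => η), wedge_cons_tail (fun _ => ξ - η),
    Subsingleton.elim (Fin.tail fun _ : Fin 1 => ξ) (Fin.tail fun _ : Fin 1 => ξ - η),
    Subsingleton.elim (Fin.tail fun _ : Fin 1 => η) (Fin.tail fun _ : Fin 1 => ξ - η),
    sub_eq_iff_eq_add, ← add_apply, ← creation_add, sub_add_cancel]

/-- The one-particle sector is an isometric copy of `ℓ²` on which `Γ(u)` acts as `u`. -/
theorem norm_sub_le_norm_secondQuantization_sub (u v : unitary (Ell2 →L[ℂ] Ell2)) :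
    ‖(u : Ell2 →L[ℂ] Ell2) - v‖ ≤ ‖secondQuantization u - secondQuantization v‖ := by
  refine ContinuousLinearMap.opNorm_le_bound _ (norm_nonneg _) fun ξ => ?_
  rw [sub_apply, ← norm_wedge_one, ← wedge_one_sub, ← norm_wedge_one ξ,
    ← secondQuantization_wedge u (fun _ : Fin 1 => ξ),
    ← secondQuantization_wedge v (fun _ : Fin 1 => ξ), ← sub_apply]
  exact ContinuousLinearMap.le_opNorm _ _

theorem secondQuantization_injective : Function.Injective secondQuantization := by
  intro u v h
  have := norm_sub_le_norm_secondQuantization_sub u v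
  rw [h, sub_self, norm_zero, norm_le_zero_iff, sub_eq_zero] at this
  exact Subtype.ext this

/-- `Γ` is not continuous from the operator norm to the operator norm, but its matrix coefficients
between wedges are finite determinants and do converge. That suffices to identify a limit already
known to exist. -/
theorem secondQuantization_eq_of_tendsto {ι : Type*} {l : Filter ι} [l.NeBot]
    {w : ι → unitary (Ell2 →L[ℂ] Ell2)} {u : unitary (Ell2 →L[ℂ] Ell2)}
    {T : FermionFock →L[ℂ] FermionFock}
    (hw : Tendsto (fun n => (w n : Ell2 →L[ℂ] Ell2)) l (𝓝 (u : Ell2 →L[ℂ] Ell2)))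
    (hT : Tendsto (fun n => secondQuantization (w n)) l (𝓝 T)) : secondQuantization u = T := by
  refine clm_ext_wedge fun q η => ext_inner_wedge fun p ζ => ?_
  have h1 : Tendsto (fun n => ⟪wedge ζ, secondQuantization (w n) (wedge η)⟫_ℂ) l
      (𝓝 ⟪wedge ζ, T (wedge η)⟫_ℂ) :=
    tendsto_const_nhds.inner (((ContinuousLinearMap.apply ℂ _ (wedge η)).continuous.tendsto T).comp hT)
  refine tendsto_nhds_unique ?_ h1
  by_cases hpq : p = q
  · subst hpq
    simp_rw [inner_wedge_secondQuantization]
    have hc : Continuous fun M : Matrix (Fin p) (Fin p) ℂ => M.det := continuous_id.matrix_det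
    refine (hc.tendsto _).comp (tendsto_pi_nhds.2 fun i => tendsto_pi_nhds.2 fun j => ?_)
    exact tendsto_const_nhds.inner
      (((ContinuousLinearMap.apply ℂ _ (η j)).continuous.tendsto (u : Ell2 →L[ℂ] Ell2)).comp hw)
  · simp_rw [secondQuantization_wedge, inner_wedge_of_ne hpq]
    exact tendsto_const_nhds

theorem norm_wedge_of_orthonormal {p : ℕ} {ξ : Fin p → Ell2} (hξ : Orthonormal ℂ ξ) :
    ‖wedge ξ‖ = 1 := by
  have h : ⟪wedge ξ, wedge ξ⟫_ℂ = 1 := by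
    rw [inner_wedge, ← Matrix.det_one (n := Fin p)]
    congr 1
    ext i j
    rw [Matrix.of_apply, orthonormal_iff_ite.1 hξ, Matrix.one_apply]
  refine (pow_eq_one_iff_of_nonneg (norm_nonneg _) two_ne_zero).1 ?_
  rw [← inner_self_eq_norm_sq (𝕜 := ℂ), h, RCLike.one_re]

/-- The determinant is the coefficient of `Γ(u)` at the unit vector `wedge ξ`. The bound is uniform
in `p`, and it is all that the lower bound uses about determinants. -/
theorem norm_det_sub_one_le (u : unitary (Ell2 →L[ℂ] Ell2)) {p : ℕ} {ξ : Fin p → Ell2}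
    (hξ : Orthonormal ℂ ξ) :
    ‖(Matrix.of fun i j => ⟪ξ i, (u : Ell2 →L[ℂ] Ell2) (ξ j)⟫_ℂ).det - 1‖ ≤
      ‖secondQuantization u - 1‖ := by
  have h1 : (1 : ℂ) = ⟪wedge ξ, wedge ξ⟫_ℂ := by
    rw [inner_self_eq_norm_sq_to_K, norm_wedge_of_orthonormal hξ]; simp
  rw [← inner_wedge_secondQuantization, h1, ← inner_sub_right]
  refine (norm_inner_le_norm _ _).trans ?_
  have h2 := (secondQuantization u - 1).le_opNorm (wedge ξ)
  rw [norm_wedge_of_orthonormal hξ, mul_one] at h2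
  rw [norm_wedge_of_orthonormal hξ, one_mul]
  exact h2

theorem secondQuantization_mem_of_rankOne (u : unitary (Ell2 →L[ℂ] Ell2)) (f : Ell2) (c : ℂ)
    (h : ∀ v, (u : Ell2 →L[ℂ] Ell2) v = v + (c * ⟪f, v⟫_ℂ) • f) :
    secondQuantization u ∈ carAlgebra := by
  rw [secondQuantization_of_rankOne u f c h]
  exact add_mem (one_mem _) (SMulMemClass.smul_mem c (mul_mem (creation_mem f) (annihilation_mem f)))

theorem norm_secondQuantization_sub_one_le_of_rankOne (u : unitary (Ell2 →L[ℂ] Ell2)) {f : Ell2}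
    (hf : ‖f‖ ≤ 1) (c : ℂ) (h : ∀ v, (u : Ell2 →L[ℂ] Ell2) v = v + (c * ⟪f, v⟫_ℂ) • f) :
    ‖secondQuantization u - 1‖ ≤ ‖c‖ := by
  rw [secondQuantization_of_rankOne u f c h, add_sub_cancel_left, norm_smul]
  refine mul_le_of_le_one_right (norm_nonneg _) ((norm_mul_le _ _).trans ?_)
  have h1 : ‖creation f‖ ≤ 1 := (norm_creation_le f).trans hf
  rw [← star_annihilation, norm_star] at *
  exact mul_le_one₀ h1 (norm_nonneg _) h1

end SecondQuantizationHom

/-! ### Trace class operators: compactness, extremal eigenvectors, additivity of the trace norm. -/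

section TraceClass

open Filter Topology InnerProductSpace

theorem isCompactOperator_rankOne {E : Type*} [NormedAddCommGroup E] [InnerProductSpace ℂ E]
    (v w : E) : IsCompactOperator (rankOne ℂ v w) := by
  have h : IsCompactOperator (ContinuousLinearMap.toSpanSingleton ℂ v) :=
    isCompactOperator_of_locallyCompactSpace_rng _
  exact h.comp_clm (innerSL ℂ w)

variable {E : Type*} [NormedAddCommGroup E] [InnerProductSpace ℂ E] [CompleteSpace E]

/-- Testing `x` against the contraction `x*/r` gives the diagonal entries `‖x (b i)‖² / r`. -/
theorem hsSq_le_mul_eTraceNorm (b : HilbertBasis ℕ ℂ E) (x : E →L[ℂ] E) {r : ℝ} (hr : 0 < r)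
    (hx : ‖x‖ ≤ r) : hsSq b x ≤ ENNReal.ofReal r * eTraceNorm b x := by
  set c : E →L[ℂ] E := (r⁻¹ : ℂ) • star x with hc
  have hc1 : ‖c‖ ≤ 1 := by
    rw [hc, norm_smul, norm_star, norm_inv, Complex.norm_real, Real.norm_of_nonneg hr.le]
    exact inv_mul_le_one_of_le₀ hx hr.le
  have hr0 : ENNReal.ofReal r ≠ 0 := by simpa using hr
  have h1 : ∀ i, ‖x (b i)‖ₑ ^ 2 = ENNReal.ofReal r * ‖⟪b i, c (x (b i))⟫_ℂ‖ₑ := by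
    intro i
    have : ⟪b i, c (x (b i))⟫_ℂ = ((r⁻¹ * ‖x (b i)‖ ^ 2 : ℝ) : ℂ) := by
      rw [hc, smul_apply, inner_smul_right, ContinuousLinearMap.star_eq_adjoint,
        ContinuousLinearMap.adjoint_inner_right, inner_self_eq_norm_sq_to_K]
      push_cast; rfl
    rw [this, ← ofReal_norm, ← ENNReal.ofReal_pow (norm_nonneg _), ← ofReal_norm,
      ← ENNReal.ofReal_mul hr.le, Complex.norm_real, Real.norm_of_nonneg (by positivity)]
    congr 1
    field_simp
  unfold hsSq
  simp_rw [h1]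
  rw [ENNReal.tsum_mul_left]
  gcongr
  rw [ENNReal.tsum_eq_iSup_sum]
  exact iSup_le fun S => sum_enorm_inner_le b x c hc1 S

theorem enorm_sq_le_hsSq (b : HilbertBasis ℕ ℂ E) (x : E →L[ℂ] E) (v : E) :
    ‖x v‖ₑ ^ 2 ≤ hsSq b x * ‖v‖ₑ ^ 2 := by
  rw [← hsSq_star, enorm_sq_eq_tsum b, hsSq, ← ENNReal.tsum_mul_right]
  refine ENNReal.tsum_le_tsum fun j => ?_
  rw [← mul_pow, ← ContinuousLinearMap.adjoint_inner_left, ← ContinuousLinearMap.star_eq_adjoint]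
  gcongr
  simp only [enorm_eq_nnnorm]
  exact_mod_cast norm_inner_le_norm (𝕜 := ℂ) _ _

theorem norm_le_of_hsSq_le (b : HilbertBasis ℕ ℂ E) (x : E →L[ℂ] E) {r : ℝ} (hr : 0 ≤ r)
    (h : hsSq b x ≤ ENNReal.ofReal (r ^ 2)) : ‖x‖ ≤ r := by
  refine ContinuousLinearMap.opNorm_le_bound _ hr fun v => ?_
  have h1 := (enorm_sq_le_hsSq b x v).trans (mul_le_mul_left h (‖v‖ₑ ^ 2))
  rw [← ofReal_norm, ← ofReal_norm, ← ENNReal.ofReal_pow (norm_nonneg _),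
    ← ENNReal.ofReal_pow (norm_nonneg _), ← ENNReal.ofReal_mul (by positivity), ← mul_pow,
    ENNReal.ofReal_le_ofReal_iff (by positivity)] at h1
  exact (pow_le_pow_iff_left₀ (norm_nonneg _) (by positivity) two_ne_zero).1 h1

/-- The finite-rank truncations of `x` to finitely many basis vectors converge in norm, since the
squared Hilbert-Schmidt norm of the error is a tail of the series `hsSq b x`. -/
theorem isCompactOperator_of_hsSq_ne_top (b : HilbertBasis ℕ ℂ E) {x : E →L[ℂ] E}
    (h : hsSq b x ≠ ∞) : IsCompactOperator x := by
  have hF : ∀ S : Finset ℕ, IsCompactOperator (∑ i ∈ S, rankOne ℂ (x (b i)) (b i) : E →L[ℂ] E) := by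
    intro S
    induction S using Finset.induction_on with
    | empty => simpa using isCompactOperator_zero
    | insert i S hi ih =>
      rw [Finset.sum_insert hi]
      exact (isCompactOperator_rankOne _ _).add ih
  refine isCompactOperator_of_tendsto (l := atTop) ?_ (Eventually.of_forall hF)
  have hS : ∀ S : Finset ℕ, hsSq b ((∑ i ∈ S, rankOne ℂ (x (b i)) (b i)) - x) =
      ∑' i : {i // i ∉ S}, ‖x (b i)‖ₑ ^ 2 := by
    intro S
    have h1 : ∀ j, (((∑ i ∈ S, rankOne ℂ (x (b i)) (b i)) - x : E →L[ℂ] E)) (b j) =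
        if j ∈ S then 0 else -x (b j) := by
      intro j
      rw [sub_apply, sum_apply]
      simp_rw [rankOne_apply, orthonormal_iff_ite.1 b.orthonormal, ite_smul, one_smul, zero_smul,
        Finset.sum_ite_eq']
      split_ifs <;> simp
    unfold hsSq
    simp_rw [h1]
    rw [← tsum_subtype_eq_of_support_subset (s := {i | i ∉ S})]
    · refine tsum_congr fun i => ?_
      rw [if_neg i.2, enorm_neg]
    · intro i hi
      by_contra h2
      simp only [Set.mem_ofPred_eq, not_not] at h2
      simp [h2] at hi
  rw [tendsto_iff_norm_sub_tendsto_zero, Metric.tendsto_nhds]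
  intro ε hε
  have h3 := (ENNReal.tendsto_tsum_compl_atTop_zero h).eventually
    (gt_mem_nhds (show (0 : ℝ≥0∞) < ENNReal.ofReal ((ε / 2) ^ 2) by
      rw [ENNReal.ofReal_pos]; positivity))
  filter_upwards [h3] with S hS2
  rw [dist_zero_right, norm_norm]
  refine (norm_le_of_hsSq_le b _ (by positivity) ?_).trans_lt (half_lt_self hε)
  rw [hS]
  exact hS2.le

theorem isCompactOperator_of_eTraceNorm_ne_top (b : HilbertBasis ℕ ℂ E) {x : E →L[ℂ] E}
    (h : eTraceNorm b x ≠ ∞) : IsCompactOperator x := by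
  refine isCompactOperator_of_hsSq_ne_top b (ne_top_of_le_ne_top (ENNReal.mul_ne_top ?_ h)
    (hsSq_le_mul_eTraceNorm b x (r := ‖x‖ + 1) (by positivity) (by linarith)))
  exact ENNReal.ofReal_ne_top

/-- For a normal operator the spectral radius equals the norm and is attained on the spectrum.
Compactness turns this nonzero spectral value into an eigenvalue. -/
theorem exists_eigenvector_norm_eq {x : E →L[ℂ] E} (hx : IsCompactOperator x) (hn : IsStarNormal x)
    (h0 : x ≠ 0) : ∃ (c : ℂ) (f : E), ‖c‖ = ‖x‖ ∧ ‖f‖ = 1 ∧ x f = c • f := by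
  have : Nontrivial (E →L[ℂ] E) := ⟨x, 0, h0⟩
  obtain ⟨c, hc, hcn⟩ := spectrum.exists_nnnorm_eq_spectralRadius x
  rw [IsStarNormal.spectralRadius_eq_nnnorm, ENNReal.coe_inj] at hcn
  have hcn' : ‖c‖ = ‖x‖ := congrArg NNReal.toReal hcn
  have hc0 : c ≠ 0 := by
    rw [← norm_ne_zero_iff, hcn', norm_ne_zero_iff]; exact h0
  obtain ⟨v, hv⟩ := ((hx.hasEigenvalue_iff_mem_spectrum hc0).2 hc).exists_hasEigenvector
  refine ⟨c, (‖v‖⁻¹ : ℂ) • v, hcn', norm_smul_inv_norm hv.2, ?_⟩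
  have hxv : x v = c • v := hv.apply_eq_smul
  rw [map_smul, hxv, smul_comm]

/-- All cross terms vanish, so the right-hand side is a positive square root of `(x + c p)* (x + c
p)`. -/
theorem abs_add_smul_projection {x p : E →L[ℂ] E} (hp : 0 ≤ p) (hpp : p * p = p) (h1 : x * p = 0)
    (h2 : p * x = 0) (c : ℂ) : CFC.abs (x + c • p) = CFC.abs x + (‖c‖ : ℂ) • p := by
  have hps : star p = p := hp.isSelfAdjoint.star_eq
  have h3 : CFC.abs x * p = 0 := by
    rw [← CStarRing.star_mul_self_eq_zero_iff, star_mul, (CFC.abs_nonneg x).isSelfAdjoint.star_eq,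
      mul_assoc, ← mul_assoc (CFC.abs x), CFC.abs_mul_abs, mul_assoc, h1, mul_zero, mul_zero]
  have h4 : p * CFC.abs x = 0 := by
    have := congrArg star h3
    rwa [star_mul, (CFC.abs_nonneg x).isSelfAdjoint.star_eq, hps, star_zero] at this
  have h5 : star x * p = 0 := by
    have := congrArg star h2
    rwa [star_mul, hps, star_zero] at this
  refine CFC.sqrt_unique ?_ ?_
  · rw [star_add, star_smul, hps]
    simp only [add_mul, mul_add, smul_mul_assoc, mul_smul_comm, h2, h3, h4, h5, hpp, smul_zero,
      add_zero, zero_add, CFC.abs_mul_abs, smul_smul]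
    congr 2
    rw [RCLike.star_def, Complex.mul_conj', sq]
  · refine add_nonneg (CFC.abs_nonneg x) ?_
    rw [ContinuousLinearMap.nonneg_iff_isPositive] at hp ⊢
    exact hp.smul_of_nonneg (by exact_mod_cast norm_nonneg c)

theorem eTraceNorm_add_smul_rankOne (b : HilbertBasis ℕ ℂ E) {x : E →L[ℂ] E} {f : E} (hf : ‖f‖ = 1)
    (h1 : x f = 0) (h2 : star x f = 0) (c : ℂ) :
    eTraceNorm b (x + c • rankOne ℂ f f) = eTraceNorm b x + ‖c‖ₑ := by
  have hp : 0 ≤ (rankOne ℂ f f : E →L[ℂ] E) := by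
    rw [ContinuousLinearMap.nonneg_iff_isPositive]; exact isPositive_rankOne_self f
  have h : CFC.abs (x + c • rankOne ℂ f f) = CFC.abs x + (‖c‖ : ℂ) • rankOne ℂ f f := by
    refine abs_add_smul_projection hp (isIdempotentElem_rankOne_self hf) ?_ ?_ c
    · ext v; simp [h1]
    · ext v
      rw [mul_apply_eq_comp, rankOne_apply, ← ContinuousLinearMap.adjoint_inner_left,
        ← ContinuousLinearMap.star_eq_adjoint, h2]
      simp
  have hf2 : ∑' i, ‖⟪b i, f⟫_ℂ‖ₑ ^ 2 = 1 := by
    rw [← enorm_sq_eq_tsum, ← ofReal_norm, hf]; simp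
  rw [eTraceNorm, h, eTraceNorm, opTrace, opTrace, ← mul_one ‖c‖ₑ, ← hf2, ← ENNReal.tsum_mul_left,
    ← ENNReal.tsum_add]
  refine tsum_congr fun i => ?_
  have hpos : 0 ≤ RCLike.re ⟪b i, CFC.abs x (b i)⟫_ℂ :=
    ((ContinuousLinearMap.nonneg_iff_isPositive _).1 (CFC.abs_nonneg x)).re_inner_nonneg_right _
  have hin : ⟪b i, ((‖c‖ : ℂ) • rankOne ℂ f f : E →L[ℂ] E) (b i)⟫_ℂ =
      ((‖c‖ * ‖⟪b i, f⟫_ℂ‖ ^ 2 : ℝ) : ℂ) := by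
    rw [smul_apply, rankOne_apply, inner_smul_right, inner_smul_right, ← inner_conj_symm f,
      Complex.conj_mul']
    push_cast; rfl
  rw [add_apply, inner_add_right, map_add, hin,
    show RCLike.re ((‖c‖ * ‖⟪b i, f⟫_ℂ‖ ^ 2 : ℝ) : ℂ) = ‖c‖ * ‖⟪b i, f⟫_ℂ‖ ^ 2 from
      Complex.ofReal_re _, ENNReal.ofReal_add hpos (by positivity), ENNReal.ofReal_mul (norm_nonneg _),
    ENNReal.ofReal_pow (norm_nonneg _), ofReal_norm, ofReal_norm]

end TraceClass

/-! ### `Γ(u)` lies in the CAR algebra, and `Γ` does not increase distances. -/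

section Membership

open Filter Topology InnerProductSpace SchattenOneUnitary

theorem eTraceNorm_unitary_sub (u v : unitary (Ell2 →L[ℂ] Ell2)) :
    eTraceNorm ell2Basis ((u : Ell2 →L[ℂ] Ell2) - v) =
      eTraceNorm ell2Basis (((v⁻¹ * u : unitary (Ell2 →L[ℂ] Ell2)) : Ell2 →L[ℂ] Ell2) - 1) := by
  rw [← eTraceNorm_unitary_mul ell2Basis v (_ - 1), mul_sub, ← Submonoid.coe_mul, mul_inv_cancel_left,
    mul_one]

theorem dist_schatten_eq (u v : SchattenOneUnitary) : dist u v = dist (v⁻¹ * u) 1 := by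
  change (eTraceNorm _ _).toReal = (eTraceNorm _ _).toReal
  rw [eTraceNorm_unitary_sub, map_mul, map_inv, map_one]
  rfl

theorem coe_inv_apply_apply (u : unitary (Ell2 →L[ℂ] Ell2)) (v : Ell2) :
    ((u⁻¹ : unitary (Ell2 →L[ℂ] Ell2)) : Ell2 →L[ℂ] Ell2) ((u : Ell2 →L[ℂ] Ell2) v) = v := by
  rw [← mul_apply_eq_comp, ← Submonoid.coe_mul, inv_mul_cancel]; rfl

/-- For a unit vector `f` and `|z| = 1`, the operator `1 + (z - 1) |f⟩⟨f|` is unitary. -/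
theorem exists_unitary_rankOne {f : Ell2} (hf : ‖f‖ = 1) {z : ℂ} (hz : ‖z‖ = 1) :
    ∃ r : unitary (Ell2 →L[ℂ] Ell2), (r : Ell2 →L[ℂ] Ell2) = 1 + (z - 1) • rankOne ℂ f f := by
  have hpp : (rankOne ℂ f f * rankOne ℂ f f : Ell2 →L[ℂ] Ell2) = rankOne ℂ f f :=
    isIdempotentElem_rankOne_self hf
  have hps : star (rankOne ℂ f f : Ell2 →L[ℂ] Ell2) = rankOne ℂ f f := adjoint_rankOne f f
  have hz2 : star z * z = 1 := by
    rw [RCLike.star_def, Complex.conj_mul', hz]; simp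
  refine ⟨⟨1 + (z - 1) • rankOne ℂ f f, ?_⟩, rfl⟩
  rw [Unitary.mem_iff, star_add, star_one, star_smul, hps]
  simp only [add_mul, mul_add, one_mul, mul_one, smul_mul_assoc, mul_smul_comm, hpp, add_assoc,
    add_eq_left]
  rw [star_sub, star_one, smul_add, smul_add, smul_smul, smul_smul, ← add_smul, ← add_smul,
    ← add_smul, ← add_smul]
  constructor
  · rw [show star z - 1 + (z - 1 + (z - 1) * (star z - 1)) = star z * z - 1 by ring, hz2, sub_self,
      zero_smul]
  · rw [show z - 1 + (star z - 1 + (star z - 1) * (z - 1)) = star z * z - 1 by ring, hz2, sub_self,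
      zero_smul]

/-- Splitting off an eigenvalue of largest distance to `1`. -/
theorem exists_peel (u : SchattenOneUnitary) : ∃ r u' : SchattenOneUnitary, u = r * u' ∧
    secondQuantization (toUnitary r) ∈ carAlgebra ∧
    ‖secondQuantization (toUnitary r) - 1‖ ≤ ‖(toUnitary u : Ell2 →L[ℂ] Ell2) - 1‖ ∧
    dist u' 1 + ‖(toUnitary u : Ell2 →L[ℂ] Ell2) - 1‖ = dist u 1 := by
  set U := toUnitary u with hU
  by_cases hu : (U : Ell2 →L[ℂ] Ell2) - 1 = 0
  · refine ⟨1, u, (one_mul u).symm, ?_, ?_, ?_⟩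
    · rw [map_one, secondQuantization_one]; exact one_mem _
    · rw [map_one, secondQuantization_one]; simp
    · rw [hu, norm_zero, add_zero]
  have hfin : eTraceNorm ell2Basis ((U : Ell2 →L[ℂ] Ell2) - 1) ≠ ∞ := u.2
  have hnorm : IsStarNormal ((U : Ell2 →L[ℂ] Ell2) - 1) := by
    refine ⟨?_⟩
    rw [star_sub, star_one, Commute, SemiconjBy]
    have h1 := Unitary.coe_star_mul_self U
    have h2 : (U : Ell2 →L[ℂ] Ell2) * star (U : Ell2 →L[ℂ] Ell2) = 1 :=
      Unitary.mul_star_self_of_mem U.2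
    simp only [sub_mul, mul_sub, h1, h2, one_mul, mul_one]
    abel
  obtain ⟨c, f, hc, hf, hxf⟩ := exists_eigenvector_norm_eq
    (isCompactOperator_of_eTraceNorm_ne_top _ hfin) hnorm hu
  have hUf : (U : Ell2 →L[ℂ] Ell2) f = (c + 1) • f := by
    rw [add_smul, ← hxf, one_smul]; simp
  have hz : ‖c + 1‖ = 1 := by
    have h1 : ‖(U : Ell2 →L[ℂ] Ell2) f‖ = ‖f‖ := by
      have := (ContinuousLinearMap.norm_map_of_mem_unitary U.2) f
      exact this
    rwa [hUf, norm_smul, hf, mul_one] at h1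
  obtain ⟨r, hr⟩ := exists_unitary_rankOne hf hz
  rw [add_sub_cancel_right] at hr
  have hff : ⟪f, f⟫_ℂ = 1 := by rw [inner_self_eq_norm_sq_to_K, hf]; simp
  have hrf : (r : Ell2 →L[ℂ] Ell2) f = (c + 1) • f := by
    rw [hr, add_apply, smul_apply, rankOne_apply, hff, one_smul, add_smul, one_smul, add_comm]
    rfl
  set W := r⁻¹ * U with hW
  have hUW : U = r * W := by rw [hW, mul_inv_cancel_left]
  have hWf : (W : Ell2 →L[ℂ] Ell2) f = f := by
    rw [hW, Submonoid.coe_mul, mul_apply_eq_comp, hUf, ← hrf, coe_inv_apply_apply]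
  have hWf' : star (W : Ell2 →L[ℂ] Ell2) f = f := by
    conv_lhs => rw [← hWf]
    exact coe_inv_apply_apply W f
  -- Both `W` and `W*` fix `f`, so the two summands are orthogonal on both sides and their trace
  -- norms add.
  have hdec : (U : Ell2 →L[ℂ] Ell2) - 1 = ((W : Ell2 →L[ℂ] Ell2) - 1) + c • rankOne ℂ f f := by
    rw [hUW, Submonoid.coe_mul, hr, add_mul, one_mul, smul_mul_assoc]
    have : (rankOne ℂ f f * (W : Ell2 →L[ℂ] Ell2) : Ell2 →L[ℂ] Ell2) = rankOne ℂ f f := by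
      ext1 v
      rw [mul_apply_eq_comp, rankOne_apply, rankOne_apply,
        ← ContinuousLinearMap.adjoint_inner_left, ← ContinuousLinearMap.star_eq_adjoint, hWf']
    rw [this]; abel
  have htr := eTraceNorm_add_smul_rankOne ell2Basis hf
    (x := (W : Ell2 →L[ℂ] Ell2) - 1) (by simp [hWf]) (by simp [hWf', star_sub]) c
  rw [← hdec] at htr
  have hWmem : W ∈ schattenOneSubgroup := by
    change eTraceNorm _ _ ≠ ∞
    rw [htr] at hfin
    exact (ENNReal.add_ne_top.1 hfin).1
  have hrmem : r ∈ schattenOneSubgroup := by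
    have : r = U * W⁻¹ := by rw [hUW, mul_inv_cancel_right]
    rw [this]
    exact mul_mem u.2 (inv_mem hWmem)
  have hrank : ∀ v, (r : Ell2 →L[ℂ] Ell2) v = v + (c * ⟪f, v⟫_ℂ) • f := by
    intro v; rw [hr]; simp [smul_smul]
  refine ⟨⟨r, hrmem⟩, ⟨W, hWmem⟩, Subtype.ext hUW,
    secondQuantization_mem_of_rankOne r f c hrank, ?_, ?_⟩
  · exact (norm_secondQuantization_sub_one_le_of_rankOne r hf.le c hrank).trans hc.le
  · change (eTraceNorm ell2Basis ((W : Ell2 →L[ℂ] Ell2) - 1)).toReal + _ =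
      (eTraceNorm ell2Basis ((U : Ell2 →L[ℂ] Ell2) - 1)).toReal
    rw [htr, ENNReal.toReal_add (by exact hWmem) (by simp), ← hc, toReal_enorm]

/-- Peeling repeatedly gives `u = V n * U n`, where `V n` is a product of rank-one perturbations of
`1`. The norms `d n = ‖U n - 1‖` sum to at most `‖u - 1‖₁`, and they bound the steps of `Γ(V n)`. -/
theorem secondQuantization_mem_and_norm_le (u : SchattenOneUnitary) :
    secondQuantization (toUnitary u) ∈ carAlgebra ∧
      ‖secondQuantization (toUnitary u) - 1‖ ≤ dist u 1 := by
  choose r s hrs hmem hnorm hdist using exists_peel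
  let U : ℕ → SchattenOneUnitary := fun n => s^[n] u
  let V : ℕ → SchattenOneUnitary := fun n => u * (U n)⁻¹
  let d : ℕ → ℝ := fun n => ‖(toUnitary (U n) : Ell2 →L[ℂ] Ell2) - 1‖
  have hU : ∀ n, U (n + 1) = s (U n) := fun n => Function.iterate_succ_apply' s n u
  have hV : ∀ n, V (n + 1) = V n * r (U n) := by
    intro n
    have h1 : (U n)⁻¹ * r (U n) = (U (n + 1))⁻¹ := by
      rw [hU, inv_mul_eq_iff_eq_mul, eq_mul_inv_iff_mul_eq]
      exact (hrs (U n)).symm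
    change u * _ = u * _ * _
    rw [mul_assoc, h1]
  have hsum : ∀ n, dist (U n) 1 + ∑ i ∈ Finset.range n, d i = dist u 1 := by
    intro n
    induction n with
    | zero => simp [U]
    | succ n ih =>
      rw [Finset.sum_range_succ, ← ih, ← hdist (U n), hU]
      ring
  have hle : ∀ n, ∑ i ∈ Finset.range n, d i ≤ dist u 1 := fun n => by
    rw [← hsum n]; linarith [dist_nonneg (x := U n) (y := 1)]
  have hd0 : ∀ n, 0 ≤ d n := fun n => norm_nonneg _
  have hds : Summable d := summable_of_sum_range_le hd0 hle
  let G : ℕ → FermionFock →L[ℂ] FermionFock := fun n => secondQuantization (toUnitary (V n))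
  have hV0 : V 0 = 1 := by simp [V, U]
  have hG0 : G 0 = 1 := by
    simp only [G, hV0, map_one, secondQuantization_one]
  have hGd : ∀ n, dist (G n) (G (n + 1)) ≤ d n := by
    intro n
    rw [dist_comm, dist_eq_norm, norm_secondQuantization_sub, ← map_inv, ← map_mul, hV,
      inv_mul_cancel_left]
    exact hnorm (U n)
  have hGmem : ∀ n, G n ∈ carAlgebra := by
    intro n
    induction n with
    | zero => rw [hG0]; exact one_mem _
    | succ n ih =>
      simp only [G, hV, map_mul, secondQuantization_mul]
      exact mul_mem ih (hmem (U n))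
  have hG1 : ∀ n, ‖G n - 1‖ ≤ dist u 1 := by
    intro n
    rw [← hG0, ← dist_eq_norm, dist_comm]
    refine (dist_le_range_sum_dist G n).trans ((Finset.sum_le_sum fun i _ => hGd i).trans (hle n))
  obtain ⟨T, hT⟩ := cauchySeq_tendsto_of_complete (cauchySeq_of_dist_le_of_summable d hGd hds)
  -- `‖V n - u‖ = d n`, the general term of a convergent series.
  have hVu : Tendsto (fun n => (toUnitary (V n) : Ell2 →L[ℂ] Ell2)) atTop
      (𝓝 (toUnitary u : Ell2 →L[ℂ] Ell2)) := by
    rw [tendsto_iff_norm_sub_tendsto_zero]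
    refine hds.tendsto_atTop_zero.congr fun n => ?_
    have : (toUnitary (V n) : Ell2 →L[ℂ] Ell2) - (toUnitary u : Ell2 →L[ℂ] Ell2) =
        -((toUnitary (V n) : Ell2 →L[ℂ] Ell2) * ((toUnitary (U n) : Ell2 →L[ℂ] Ell2) - 1)) := by
      rw [mul_sub, ← Submonoid.coe_mul, ← map_mul, inv_mul_cancel_right, mul_one, neg_sub]
    rw [this, norm_neg, CStarRing.norm_coe_unitary_mul]
  rw [secondQuantization_eq_of_tendsto hVu hT]
  refine ⟨?_, le_of_tendsto ((hT.sub_const 1).norm) (Eventually.of_forall hG1)⟩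
  exact (StarSubalgebra.isClosed_topologicalClosure _).mem_of_tendsto hT
    (Eventually.of_forall hGmem)

end Membership

/-! ### Growth of the argument of a determinant when a matrix is bordered. -/

section Determinant

open Matrix

theorem im_inner_mulVec_eq {n : ℕ} (M : Matrix (Fin n) (Fin n) ℂ) (β : Fin n → ℝ)
    (hM : ∀ i j, M i j - star (M j i) = if i = j then 2 * Complex.I * (β i : ℂ) else 0)
    (x : Fin n → ℂ) : (star x ⬝ᵥ (M *ᵥ x)).im = ∑ i, β i * ‖x i‖ ^ 2 := by
  have h1 : star x ⬝ᵥ (M *ᵥ x) - star (star x ⬝ᵥ (M *ᵥ x)) =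
      2 * Complex.I * ((∑ i, β i * ‖x i‖ ^ 2 : ℝ) : ℂ) := by
    have e1 : star x ⬝ᵥ (M *ᵥ x) = ∑ i, ∑ j, star (x i) * x j * M i j := by
      simp only [dotProduct, mulVec, Pi.star_apply, Finset.mul_sum]
      exact Finset.sum_congr rfl fun i _ => Finset.sum_congr rfl fun j _ => by ring
    have e2 : star (star x ⬝ᵥ (M *ᵥ x)) = ∑ i, ∑ j, star (x i) * x j * star (M j i) := by
      rw [e1, star_sum]
      simp only [star_sum, star_mul', star_star]
      rw [Finset.sum_comm]
      exact Finset.sum_congr rfl fun i _ => Finset.sum_congr rfl fun j _ => by ring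
    rw [e2, e1, ← Finset.sum_sub_distrib, Complex.ofReal_sum, Finset.mul_sum]
    refine Finset.sum_congr rfl fun i _ => ?_
    rw [← Finset.sum_sub_distrib]
    simp_rw [← mul_sub, hM, mul_ite, mul_zero]
    rw [Finset.sum_ite_eq, if_pos (Finset.mem_univ i), RCLike.star_def, Complex.conj_mul']
    push_cast
    ring
  have h2 := congrArg Complex.im h1
  rw [Complex.sub_im, RCLike.star_def, Complex.conj_im, Complex.im_mul_ofReal] at h2
  simp only [Complex.mul_im, Complex.re_ofNat, Complex.I_im, Complex.im_ofNat, Complex.I_re] at h2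
  linarith

/-- The quotient is the value of the quadratic form of `M` at a vector `x` with last entry `1`. Its
imaginary part is `∑ β i |x i|²`, which is at least the last term. -/
theorem le_im_det_div_det {n : ℕ} (M : Matrix (Fin (n + 1)) (Fin (n + 1)) ℂ) (β : Fin (n + 1) → ℝ)
    (hβ : ∀ i, 0 ≤ β i)
    (hM : ∀ i j, M i j - star (M j i) = if i = j then 2 * Complex.I * (β i : ℂ) else 0)
    (hd : (M.submatrix Fin.castSucc Fin.castSucc).det ≠ 0) :
    β (Fin.last n) ≤ (M.det / (M.submatrix Fin.castSucc Fin.castSucc).det).im := by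
  set d := (M.submatrix Fin.castSucc Fin.castSucc).det with hd'
  -- The last column of the adjugate is scaled so that `M x` is `det M / d` times the last basis
  -- vector. This works even if `M` is singular.
  let x : Fin (n + 1) → ℂ := fun i => M.adjugate i (Fin.last n) / d
  have hx : x (Fin.last n) = 1 := by
    simp only [x]
    rw [adjugate_fin_succ_eq_det_submatrix, Fin.succAbove_last, ← two_mul, pow_mul]
    simp [← hd', hd]
  have hMx : ∀ i, (M *ᵥ x) i = if i = Fin.last n then M.det / d else 0 := by
    intro i
    have := congrFun (congrFun (mul_adjugate M) i) (Fin.last n)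
    rw [mul_apply] at this
    simp only [mulVec, dotProduct, x, mul_div_assoc', ← Finset.sum_div, this, Matrix.smul_apply,
      one_apply, smul_eq_mul, mul_ite, mul_one, mul_zero]
    split_ifs <;> simp
  have h1 := im_inner_mulVec_eq M β hM x
  have h2 : star x ⬝ᵥ (M *ᵥ x) = M.det / d := by
    simp [dotProduct, hMx, hx]
  rw [h2] at h1
  rw [h1]
  refine le_trans ?_ (Finset.single_le_sum (fun i _ => mul_nonneg (hβ i) (sq_nonneg ‖x i‖))
    (Finset.mem_univ (Fin.last n)))
  simp [hx]

theorem abs_arg_le {w : ℂ} (hw : ‖w - 1‖ ≤ 1 / 2) : |w.arg| ≤ 3 / 2 * ‖w - 1‖ := by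
  have := Complex.norm_log_one_add_half_le_self hw
  rw [add_sub_cancel] at this
  rw [← Complex.log_im]
  exact (Complex.abs_im_le_norm _).trans this

/-- Here `‖d'/d - 1‖ ≤ (1/5)/(9/10) ≤ 1/4`, so arguments add without wrapping around. Then `Im z =
|z| sin (arg z) ≤ (3/2) arg z` for `z = d'/d`. -/
theorem le_arg_sub_arg {d d' : ℂ} {β : ℝ} (hd : ‖d - 1‖ ≤ 1 / 10) (hd' : ‖d' - 1‖ ≤ 1 / 10)
    (hβ : 0 ≤ β) (h : β ≤ (d' / d).im) : β ≤ 3 / 2 * (d'.arg - d.arg) := by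
  have hdn : 9 / 10 ≤ ‖d‖ := by
    have := norm_sub_norm_le 1 d
    rw [norm_one, norm_sub_rev] at this
    linarith
  have hd0 : d ≠ 0 := norm_pos_iff.1 (by linarith)
  have hS : ‖d' / d - 1‖ ≤ 1 / 4 := by
    rw [div_sub_one hd0, norm_div, div_le_iff₀ (by linarith)]
    have : ‖d' - d‖ ≤ ‖d' - 1‖ + ‖d - 1‖ := by
      rw [← norm_neg (d - 1)]
      refine le_of_eq_of_le ?_ (norm_add_le _ _)
      congr 1; ring
    linarith
  have hSn : ‖d' / d‖ ≤ 3 / 2 := by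
    have := norm_add_le (d' / d - 1) 1
    rw [sub_add_cancel, norm_one] at this
    linarith
  have hS0 : d' / d ≠ 0 := by
    intro h0; rw [h0] at hS; norm_num at hS
  have ha := abs_le.1 (abs_arg_le (hS.trans (by norm_num)))
  have hb := abs_le.1 (abs_arg_le (hd.trans (by norm_num)))
  have hpi := Real.pi_gt_three
  have harg : d'.arg = d.arg + (d' / d).arg := by
    rw [← Complex.arg_mul hd0 hS0 ⟨by linarith, by linarith⟩, mul_div_cancel₀ _ hd0]
  have hnn : 0 ≤ (d' / d).arg := Complex.arg_nonneg_iff.2 (hβ.trans h)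
  have him : (d' / d).im ≤ ‖d' / d‖ * (d' / d).arg := by
    rw [← Complex.norm_mul_sin_arg]
    exact mul_le_mul_of_nonneg_left (Real.sin_le hnn) (norm_nonneg _)
  rw [harg, add_sub_cancel_left]
  exact h.trans (him.trans (mul_le_mul_of_nonneg_right hSn hnn))

end Determinant

/-! ### From determinants near `1` to a trace norm bound. -/

section Converse

open InnerProductSpace Module

variable {E : Type*} [NormedAddCommGroup E] [InnerProductSpace ℂ E] [CompleteSpace E]

/-- The arguments of the leading principal minors telescope, from the empty minor with argument `0`.
Keeping every minor near `1` prevents the total from escaping by a multiple of `2π`. -/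
theorem sum_le_arg_det (T : E →L[ℂ] E)
    (hT : ∀ (n : ℕ) (ξ : Fin n → E), Orthonormal ℂ ξ →
      ‖(Matrix.of fun i j => ⟪ξ i, T (ξ j)⟫_ℂ).det - 1‖ ≤ 1 / 10) (n : ℕ) :
    ∀ (ξ : Fin n → E) (β : Fin n → ℝ), Orthonormal ℂ ξ → (∀ i, 0 ≤ β i) →
      (∀ i j, ⟪ξ i, (T - star T) (ξ j)⟫_ℂ = if i = j then 2 * Complex.I * (β i : ℂ) else 0) →
      ∑ i, β i ≤ 3 / 2 * (Matrix.of fun i j => ⟪ξ i, T (ξ j)⟫_ℂ).det.arg := by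
  induction n with
  | zero => intro ξ β _ _ _; simp
  | succ n ih =>
    intro ξ β hξ hβ h
    have hξ' : Orthonormal ℂ fun i : Fin n => ξ i.castSucc :=
      hξ.comp _ (Fin.castSucc_injective n)
    have h1 := ih _ (fun i => β i.castSucc) hξ' (fun i => hβ _) fun i j => by
      rw [h]; simp only [Fin.castSucc_inj]
    have h2 := hT _ _ hξ'
    have h3 := le_im_det_div_det (Matrix.of fun i j => ⟪ξ i, T (ξ j)⟫_ℂ) β hβ (fun i j => by
      rw [← h, Matrix.of_apply, Matrix.of_apply, sub_apply, inner_sub_right,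
        ContinuousLinearMap.star_eq_adjoint, ContinuousLinearMap.adjoint_inner_right,
        RCLike.star_def, inner_conj_symm]) (by
      intro h0
      have e : (Matrix.of fun i j : Fin n => ⟪ξ i.castSucc, T (ξ j.castSucc)⟫_ℂ).det = 0 := h0
      rw [e] at h2
      norm_num at h2)
    have h4 := le_arg_sub_arg h2 (hT _ _ hξ) (hβ _) h3
    rw [Fin.sum_univ_castSucc]
    linarith

/-- The subfamily indexed by `S` is again diagonalizing. The constant is `9/4 = (3/2)²`: one factor
from `sum_le_arg_det`, one from `abs_arg_le`. -/
theorem sum_le_of_diagonal {T : E →L[ℂ] E} {δ : ℝ} (hδ : δ ≤ 1 / 10)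
    (hT : ∀ (n : ℕ) (ξ : Fin n → E), Orthonormal ℂ ξ →
      ‖(Matrix.of fun i j => ⟪ξ i, T (ξ j)⟫_ℂ).det - 1‖ ≤ δ) {n : ℕ}
    {ξ : Fin n → E} {β : Fin n → ℝ} (hξ : Orthonormal ℂ ξ)
    (h : ∀ i j, ⟪ξ i, (T - star T) (ξ j)⟫_ℂ = if i = j then 2 * Complex.I * (β i : ℂ) else 0)
    (S : Finset (Fin n)) (hβ : ∀ i ∈ S, 0 ≤ β i) : ∑ i ∈ S, β i ≤ 9 / 4 * δ := by
  let e : Fin S.card ≃ S := S.equivFin.symm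
  have he : Function.Injective fun i => (e i : Fin n) := Subtype.val_injective.comp e.injective
  have hξ' : Orthonormal ℂ fun i => ξ (e i) := hξ.comp _ he
  have h1 := sum_le_arg_det T (fun n ξ hξ => (hT n ξ hξ).trans hδ) _ _ (fun i => β (e i)) hξ'
    (fun i => hβ _ (e i).2) fun i j => by rw [h]; simp only [he.eq_iff]
  have h2 := hT _ _ hξ'
  have h3 := (le_abs_self _).trans (abs_arg_le ((h2.trans hδ).trans (by norm_num)))
  rw [← Finset.sum_coe_sort S, ← e.sum_comp]
  linarith

theorem exists_diagonal (h : E →L[ℂ] E) (hh : IsSelfAdjoint h) (s : Finset E) :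
    ∃ (n : ℕ) (ξ : Fin n → E) (β : Fin n → ℝ), Orthonormal ℂ ξ ∧
      (∀ i j, ⟪ξ i, h (ξ j)⟫_ℂ = if i = j then (β i : ℂ) else 0) ∧
      ∀ v ∈ s, h v = ∑ j, ((β j : ℂ) * ⟪ξ j, v⟫_ℂ) • ξ j := by
  classical
  -- Including `h(s)` makes the compression of `h` to `V` agree with `h` on `s`, although `V` need
  -- not be invariant.
  let V : Submodule ℂ E := Submodule.span ℂ (s ∪ s.image h : Finset E)
  have : FiniteDimensional ℂ V := FiniteDimensional.span_finset ℂ _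
  let T : V →ₗ[ℂ] V := V.orthogonalProjectionOnto.toLinearMap ∘ₗ h.toLinearMap ∘ₗ V.subtype
  have hTl : ∀ v w : V, ⟪v, T w⟫_ℂ = ⟪(v : E), h w⟫_ℂ := fun v w =>
    V.inner_orthogonalProjectionOnto_eq_of_mem_left v (h w)
  have hhs : ∀ v w : E, ⟪h v, w⟫_ℂ = ⟪v, h w⟫_ℂ := fun v w => by
    rw [← ContinuousLinearMap.adjoint_inner_right, ← ContinuousLinearMap.star_eq_adjoint,
      hh.star_eq]
  have hT : T.IsSymmetric := fun v w => by
    rw [hTl, ← inner_conj_symm, hTl, inner_conj_symm, hhs]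
  let ξ := hT.eigenvectorBasis rfl
  let β := hT.eigenvalues rfl
  have hξ : ∀ j, T (ξ j) = (β j : ℂ) • ξ j := fun j => hT.apply_eigenvectorBasis rfl j
  refine ⟨_, fun i => ξ i, β, ?_, ?_, ?_⟩
  · exact ξ.orthonormal.comp_linearIsometry V.subtypeₗᵢ
  · intro i j
    rw [← hTl, hξ, inner_smul_right, orthonormal_iff_ite.1 ξ.orthonormal]
    split_ifs with hij
    · rw [hij, mul_one]
    · rw [mul_zero]
  · intro v hv
    have hv1 : v ∈ V := Submodule.subset_span (by simp [hv])
    have hv2 : h v ∈ V := Submodule.subset_span (by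
      simp only [Finset.coe_union, Finset.coe_image]
      exact Or.inr ⟨v, hv, rfl⟩)
    have h1 : T ⟨v, hv1⟩ = ⟨h v, hv2⟩ := V.orthogonalProjectionOnto_mem_subspace_eq_self ⟨h v, hv2⟩
    have h2 := ξ.sum_repr' (T ⟨v, hv1⟩)
    have h3 := congrArg Subtype.val h2
    rw [h1] at h3
    change _ = h v at h3
    rw [← h3, Submodule.coe_sum]
    refine Finset.sum_congr rfl fun j _ => ?_
    rw [Submodule.coe_smul, ← h1, ← hT, hξ, inner_smul_left, Complex.conj_ofReal]
    rfl

/-- The trace norm is tested on a contraction `c` and finitely many `b i`, on which `h` is replaced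
by a diagonal compression. The inequality `st ≤ (s² + t²)/2` and Bessel's inequality for `ξ j` and
`c (ξ j)` give each `|β j|` a coefficient at most `1`. -/
theorem eTraceNorm_le_of_diagonal (b : HilbertBasis ℕ ℂ E) {h : E →L[ℂ] E} (hh : IsSelfAdjoint h)
    {r : ℝ} (hr : ∀ (n : ℕ) (ξ : Fin n → E) (β : Fin n → ℝ), Orthonormal ℂ ξ →
      (∀ i j, ⟪ξ i, h (ξ j)⟫_ℂ = if i = j then (β i : ℂ) else 0) → ∑ i, |β i| ≤ r) :
    eTraceNorm b h ≤ ENNReal.ofReal r := by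
  classical
  refine eTraceNorm_le_of_forall b h _ fun c hc S => ?_
  obtain ⟨n, ξ, β, hξ, hd, hv⟩ := exists_diagonal h hh (S.image b)
  have h1 : ∀ i ∈ S, ‖⟪b i, c (h (b i))⟫_ℂ‖ ≤
      ∑ j, |β j| * ((‖⟪b i, ξ j⟫_ℂ‖ ^ 2 + ‖⟪b i, c (ξ j)⟫_ℂ‖ ^ 2) / 2) := by
    intro i hi
    rw [hv _ (Finset.mem_image_of_mem b hi), map_sum, inner_sum]
    refine (norm_sum_le _ _).trans (Finset.sum_le_sum fun j _ => ?_)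
    rw [map_smul, inner_smul_right, norm_mul, norm_mul, Complex.norm_real, Real.norm_eq_abs,
      mul_assoc, ← norm_inner_symm (b i)]
    refine mul_le_mul_of_nonneg_left ?_ (abs_nonneg _)
    nlinarith [sq_nonneg (‖⟪b i, ξ j⟫_ℂ‖ - ‖⟪b i, c (ξ j)⟫_ℂ‖)]
  have h2 : ∑ i ∈ S, ‖⟪b i, c (h (b i))⟫_ℂ‖ ≤ r := by
    refine (Finset.sum_le_sum h1).trans ?_
    rw [Finset.sum_comm]
    refine le_trans (Finset.sum_le_sum fun j _ => ?_) (hr n ξ β hξ hd)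
    rw [← Finset.mul_sum, ← Finset.sum_div, Finset.sum_add_distrib]
    refine mul_le_of_le_one_right (abs_nonneg _) ?_
    have e1 := b.orthonormal.sum_inner_products_le (ξ j) (s := S)
    have e2 := b.orthonormal.sum_inner_products_le (c (ξ j)) (s := S)
    have e3 : ‖c (ξ j)‖ ≤ 1 := by
      simpa [hξ.1 j] using c.le_of_opNorm_le hc (ξ j)
    rw [hξ.1 j] at e1
    have e4 : ‖c (ξ j)‖ ^ 2 ≤ 1 := pow_le_one₀ (norm_nonneg _) e3
    linarith
  simp_rw [← ofReal_norm]
  rw [← ENNReal.ofReal_sum_of_nonneg fun _ _ => norm_nonneg _]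
  exact ENNReal.ofReal_le_ofReal h2

theorem eTraceNorm_I_smul (b : HilbertBasis ℕ ℂ E) (x : E →L[ℂ] E) :
    eTraceNorm b (Complex.I • x) = eTraceNorm b x := by
  rw [eTraceNorm, eTraceNorm, CFC.abs_smul, Complex.norm_I, one_smul]

/-- With `x = u - 1`, unitarity gives `x = -k + i h`, where `k = x* x / 2` is quadratic in `x`.
Since `‖x‖ ≤ 1`, `k` absorbs at most half of `x`, so `‖x v‖ ≤ 2 ‖h v‖`. Hence `Tr k ≤ 2 Tr h² ≤ 2
‖h‖₁`, and `h` itself contributes one more `‖h‖₁`. -/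
theorem eTraceNorm_unitary_sub_one_le (b : HilbertBasis ℕ ℂ E) (u : unitary (E →L[ℂ] E))
    (hu : ‖(u : E →L[ℂ] E) - 1‖ ≤ 1) :
    eTraceNorm b ((u : E →L[ℂ] E) - 1) ≤
      3 * eTraceNorm b (-(Complex.I / 2) • ((u : E →L[ℂ] E) - star (u : E →L[ℂ] E))) := by
  set U := (u : E →L[ℂ] E) with hU
  set x := U - 1 with hx
  set h := -(Complex.I / 2) • (U - star U) with hh
  set k := (1 / 2 : ℝ) • (star x * x) with hk
  have h1 : star U * U = 1 := Unitary.star_mul_self_of_mem u.2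
  have hxk : x = -k + Complex.I • h := by
    have e1 : star x * x = (2 : ℂ) • 1 - U - star U := by
      rw [hx, star_sub, star_one, sub_mul, mul_sub, h1, two_smul]
      simp only [mul_one, one_mul]
      abel
    have e2 : Complex.I * -(Complex.I / 2) = 1 / 2 := by
      linear_combination (-1 / 2 : ℂ) * Complex.I_mul_I
    have e3 : k = (1 / 2 : ℂ) • (star x * x) := by
      rw [hk, show (1 / 2 : ℂ) = ((1 / 2 : ℝ) : ℂ) by norm_num, Complex.coe_smul]
    rw [e3, e1, hh, smul_smul, e2, hx]
    module
  have hk0 : 0 ≤ k := smul_nonneg (by norm_num) (star_mul_self_nonneg x)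
  have hkb : ∀ v, ‖k v‖ ≤ 1 / 2 * ‖x v‖ := by
    intro v
    rw [hk, smul_apply, norm_smul, Real.norm_of_nonneg (by norm_num), mul_apply_eq_comp]
    gcongr
    refine ((star x).le_of_opNorm_le ?_ _).trans_eq (one_mul _)
    rw [norm_star]; exact hu
  have hxh : ∀ v, ‖x v‖ ≤ 2 * ‖h v‖ := by
    intro v
    have e1 : ‖x v‖ ≤ ‖k v‖ + ‖h v‖ := by
      conv_lhs => rw [hxk]
      rw [add_apply]
      refine (norm_add_le _ _).trans_eq ?_
      rw [neg_apply, norm_neg, smul_apply h, norm_smul, Complex.norm_I, one_mul]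
    linarith [hkb v]
  have hh1 : ‖h‖ ≤ 1 := by
    have e1 : ‖U - star U‖ ≤ 2 := by
      have : U - star U = x - star x := by rw [hx, star_sub, star_one]; abel
      rw [this]
      refine (norm_sub_le _ _).trans ?_
      rw [norm_star]; linarith
    rw [hh, norm_smul, norm_neg, norm_div, Complex.norm_I, Complex.norm_ofNat]
    linarith
  have hkt : eTraceNorm b k ≤ 2 * hsSq b h := by
    rw [eTraceNorm, CFC.abs_of_nonneg k hk0, opTrace, hsSq, ← ENNReal.tsum_mul_left]
    refine ENNReal.tsum_le_tsum fun i => ?_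
    have e1 : RCLike.re ⟪b i, k (b i)⟫_ℂ = 1 / 2 * ‖x (b i)‖ ^ 2 := by
      rw [hk, smul_apply, mul_apply_eq_comp, inner_smul_right_eq_smul,
        ContinuousLinearMap.star_eq_adjoint, ContinuousLinearMap.adjoint_inner_right,
        RCLike.smul_re, inner_self_eq_norm_sq]
    rw [e1, ← ofReal_norm, ← ENNReal.ofReal_pow (norm_nonneg _),
      show (2 : ℝ≥0∞) = ENNReal.ofReal 2 by simp, ← ENNReal.ofReal_mul (by norm_num)]
    refine ENNReal.ofReal_le_ofReal ?_
    have := pow_le_pow_left₀ (norm_nonneg _) (hxh (b i)) 2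
    rw [mul_pow] at this
    linarith
  have hhs : hsSq b h ≤ eTraceNorm b h := by
    simpa using hsSq_le_mul_eTraceNorm b h one_pos hh1
  calc eTraceNorm b x ≤ eTraceNorm b k + eTraceNorm b h := by
        conv_lhs => rw [hxk]
        refine (eTraceNorm_add_le _ _ _).trans ?_
        rw [eTraceNorm_neg, eTraceNorm_I_smul]
    _ ≤ 2 * eTraceNorm b h + eTraceNorm b h := by
        gcongr
        exact hkt.trans (by gcongr)
    _ = 3 * eTraceNorm b h := by ring

theorem eTraceNorm_sub_one_le_of_det (b : HilbertBasis ℕ ℂ E) (u : unitary (E →L[ℂ] E)) {δ : ℝ}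
    (hδ : δ ≤ 1 / 10) (hu : ‖(u : E →L[ℂ] E) - 1‖ ≤ 1)
    (h1 : ∀ (n : ℕ) (ξ : Fin n → E), Orthonormal ℂ ξ →
      ‖(Matrix.of fun i j => ⟪ξ i, (u : E →L[ℂ] E) (ξ j)⟫_ℂ).det - 1‖ ≤ δ)
    (h2 : ∀ (n : ℕ) (ξ : Fin n → E), Orthonormal ℂ ξ →
      ‖(Matrix.of fun i j => ⟪ξ i, star (u : E →L[ℂ] E) (ξ j)⟫_ℂ).det - 1‖ ≤ δ) :
    eTraceNorm b ((u : E →L[ℂ] E) - 1) ≤ ENNReal.ofReal (14 * δ) := by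
  set U := (u : E →L[ℂ] E) with hU
  set h := -(Complex.I / 2) • (U - star U) with hh
  have hsa : IsSelfAdjoint h := by
    rw [IsSelfAdjoint, hh, star_smul, star_sub, star_star, star_neg, ← neg_sub U, smul_neg,
      ← neg_smul]
    congr 1
    simp [RCLike.star_def, neg_div]
  have hUh : U - star U = (2 * Complex.I) • h := by
    rw [hh, smul_smul, show 2 * Complex.I * -(Complex.I / 2) = 1 by
      linear_combination (-1 : ℂ) * Complex.I_mul_I, one_smul]
  -- The empty family gives a norm bounded by `δ`.
  have h0 : 0 ≤ δ := (norm_nonneg _).trans (h1 0 Fin.elim0 ⟨fun i => i.elim0, fun i => i.elim0⟩)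
  have key : eTraceNorm b h ≤ ENNReal.ofReal (9 / 2 * δ) := by
    refine eTraceNorm_le_of_diagonal b hsa fun n ξ β hξ hd => ?_
    -- The nonnegative eigenvalues are bounded through `u`. The negative ones are bounded through
    -- `u*`, whose imaginary part is `-h`. Together they give `9/2 δ`, and `3 · 9/2 ≤ 14`.
    have hp := sum_le_of_diagonal hδ h1 hξ (β := β) (fun i j => by
      rw [hUh, smul_apply, inner_smul_right, hd, mul_ite, mul_zero])
      (Finset.univ.filter fun i => 0 ≤ β i) (by simp)
    have hn := sum_le_of_diagonal hδ h2 hξ (β := fun i => -β i) (fun i j => by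
      rw [star_star, ← neg_sub, hUh, neg_apply, smul_apply, inner_neg_right, inner_smul_right, hd]
      split_ifs <;> simp)
      (Finset.univ.filter fun i => ¬ 0 ≤ β i) (fun i hi => by
        simp only [Finset.mem_filter, Finset.mem_univ, true_and, not_le] at hi
        linarith)
    rw [← Finset.sum_filter_add_sum_filter_not _ fun i => 0 ≤ β i]
    have e1 : ∑ i with 0 ≤ β i, |β i| = ∑ i with 0 ≤ β i, β i :=
      Finset.sum_congr rfl fun i hi => abs_of_nonneg (by simpa using hi)
    have e2 : ∑ i with ¬ 0 ≤ β i, |β i| = ∑ i with ¬ 0 ≤ β i, -β i :=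
      Finset.sum_congr rfl fun i hi => abs_of_neg (by simpa using hi)
    rw [e1, e2]
    linarith
  refine (eTraceNorm_unitary_sub_one_le b u hu).trans ?_
  calc 3 * eTraceNorm b h ≤ 3 * ENNReal.ofReal (9 / 2 * δ) := by gcongr
    _ = ENNReal.ofReal (3 * (9 / 2 * δ)) := by
        rw [ENNReal.ofReal_mul (p := 3) (by norm_num)]; simp
    _ ≤ _ := ENNReal.ofReal_le_ofReal (by linarith)

theorem eTraceNorm_sub_one_le (u : unitary (Ell2 →L[ℂ] Ell2))
    (h : ‖secondQuantization u - 1‖ ≤ 1 / 10) :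
    eTraceNorm ell2Basis ((u : Ell2 →L[ℂ] Ell2) - 1) ≤
      ENNReal.ofReal (14 * ‖secondQuantization u - 1‖) := by
  have hstar : ‖secondQuantization u⁻¹ - 1‖ = ‖secondQuantization u - 1‖ := by
    rw [← star_secondQuantization, ← norm_star, star_sub, star_star, star_one]
  refine eTraceNorm_sub_one_le_of_det ell2Basis u h ?_
    (fun n ξ hξ => norm_det_sub_one_le u hξ) (fun n ξ hξ => ?_)
  · have := norm_sub_le_norm_secondQuantization_sub u 1
    rw [secondQuantization_one] at this
    exact this.trans (h.trans (by norm_num))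
  · rw [← hstar]
    exact norm_det_sub_one_le u⁻¹ hξ

end Converse

/-! ### The embedding, closedness of its range, and the theorem. -/

section Main

open Filter Topology SchattenOneUnitary

/-- A group homomorphism that is a topological embedding is an isomorphism of topological groups
onto its range. -/
noncomputable def embeddingEquivRange {G H : Type*} [Group G] [Group H] [TopologicalSpace G]
    [TopologicalSpace H] (φ : G →* H) (hφ : IsEmbedding φ) : G ≃ₜ* φ.range :=
  { MonoidHom.ofInjective hφ.injective with
    continuous_toFun := hφ.continuous.subtype_mk _
    continuous_invFun := by
      refine hφ.isInducing.continuous_iff.2 ?_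
      refine continuous_subtype_val.congr fun y => ?_
      exact (congrArg Subtype.val ((MonoidHom.ofInjective hφ.injective).apply_symm_apply y)).symm }

theorem norm_secondQuantization_sub_le_dist (u v : SchattenOneUnitary) :
    ‖secondQuantization (toUnitary u) - secondQuantization (toUnitary v)‖ ≤ dist u v := by
  rw [norm_secondQuantization_sub, ← map_inv, ← map_mul, dist_schatten_eq]
  exact (secondQuantization_mem_and_norm_le _).2

theorem dist_le_norm_secondQuantization_sub {u v : SchattenOneUnitary}
    (h : ‖secondQuantization (toUnitary u) - secondQuantization (toUnitary v)‖ ≤ 1 / 10) :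
    dist u v ≤ 14 * ‖secondQuantization (toUnitary u) - secondQuantization (toUnitary v)‖ := by
  rw [norm_secondQuantization_sub] at h ⊢
  have := ENNReal.toReal_mono ENNReal.ofReal_ne_top (eTraceNorm_sub_one_le _ h)
  rwa [ENNReal.toReal_ofReal (by positivity), ← eTraceNorm_unitary_sub] at this

theorem isEmbedding_secondQuantization :
    IsEmbedding fun u : SchattenOneUnitary => secondQuantization (toUnitary u) := by
  refine ⟨IsUniformInducing.isInducing ?_,
    secondQuantization_injective.comp Subtype.val_injective⟩
  rw [Metric.isUniformInducing_iff]
  constructor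
  · refine LipschitzWith.uniformContinuous (K := 1) (LipschitzWith.of_dist_le_mul fun u v => ?_)
    rw [NNReal.coe_one, one_mul, dist_eq_norm]
    exact norm_secondQuantization_sub_le_dist u v
  · intro ε hε
    -- The inverse estimate, with constant `14`, is available only within distance `1/10`.
    refine ⟨min (1 / 10) (ε / 14), by positivity, fun {u v} h => ?_⟩
    rw [dist_eq_norm] at h
    have h1 := h.trans_le (min_le_left _ _)
    have h2 := h.trans_le (min_le_right _ _)
    have h3 := dist_le_norm_secondQuantization_sub h1.le
    linarith

/-- Norm convergence of `Γ(w n)` forces norm convergence of `w n` to a unitary `A` with `Γ(A)` the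
limit. Only membership of `A` in `𝒰₁` remains. -/
theorem isClosed_range_secondQuantization :
    IsClosed (Set.range fun u : SchattenOneUnitary => secondQuantization (toUnitary u)) := by
  refine IsSeqClosed.isClosed fun x T hx hT => ?_
  choose w hw using hx
  have hw' : Tendsto (fun n => secondQuantization (toUnitary (w n))) atTop (𝓝 T) :=
    hT.congr fun n => (hw n).symm
  have hc : CauchySeq fun n => (toUnitary (w n) : Ell2 →L[ℂ] Ell2) := by
    rw [Metric.cauchySeq_iff]
    intro ε hε
    obtain ⟨N, hN⟩ := Metric.cauchySeq_iff.1 hw'.cauchySeq ε hε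
    refine ⟨N, fun m hm n hn => lt_of_le_of_lt ?_ (hN m hm n hn)⟩
    rw [dist_eq_norm, dist_eq_norm]
    exact norm_sub_le_norm_secondQuantization_sub _ _
  obtain ⟨A, hA⟩ := cauchySeq_tendsto_of_complete hc
  have hAu : A ∈ unitary (Ell2 →L[ℂ] Ell2) :=
    isClosed_unitary.mem_of_tendsto hA (Eventually.of_forall fun n => (toUnitary (w n)).2)
  have hΓ : secondQuantization ⟨A, hAu⟩ = T := secondQuantization_eq_of_tendsto hA hw'
  obtain ⟨n, hn⟩ := ((tendsto_iff_norm_sub_tendsto_zero.1 hw').eventually_le_const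
    (show (0 : ℝ) < 1 / 10 by norm_num)).exists
  rw [← hΓ, norm_sub_rev, norm_secondQuantization_sub] at hn
  -- A single `w n` with `Γ(w n)` within `1/10` of the limit suffices: `A` differs from it by a
  -- factor in `𝒰₁`.
  have h1 : (toUnitary (w n))⁻¹ * ⟨A, hAu⟩ ∈ schattenOneSubgroup :=
    ne_top_of_le_ne_top ENNReal.ofReal_ne_top (eTraceNorm_sub_one_le _ hn)
  have h2 : (⟨A, hAu⟩ : unitary (Ell2 →L[ℂ] Ell2)) ∈ schattenOneSubgroup := by
    have := mul_mem (w n).2 h1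
    rwa [show (w n).1 = toUnitary (w n) from rfl, mul_inv_cancel_left] at this
  exact ⟨⟨_, h2⟩, hΓ⟩

/-- Second quantization as a homomorphism from `𝒰₁(ℓ²)` to the unitary group of `CAR(ℓ²)`. -/
noncomputable def secondQuantizationCAR : SchattenOneUnitary →* unitary carAlgebra where
  toFun u := ⟨⟨secondQuantization (toUnitary u), (secondQuantization_mem_and_norm_le u).1⟩, by
    have h := Unitary.mem_iff.1 (secondQuantization_mem_unitary (toUnitary u))
    exact Unitary.mem_iff.2 ⟨Subtype.ext h.1, Subtype.ext h.2⟩⟩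
  map_one' := Subtype.ext (Subtype.ext
    (show secondQuantization (toUnitary 1) = 1 by rw [map_one, secondQuantization_one]))
  map_mul' u v := Subtype.ext (Subtype.ext
    (show secondQuantization (toUnitary (u * v)) =
        secondQuantization (toUnitary u) * secondQuantization (toUnitary v) by
      rw [map_mul, secondQuantization_mul]))

theorem isEmbedding_secondQuantizationCAR : IsEmbedding secondQuantizationCAR :=
  (IsEmbedding.of_comp_iff (IsEmbedding.subtypeVal.comp IsEmbedding.subtypeVal)).1
    isEmbedding_secondQuantization

theorem isClosed_range_secondQuantizationCAR :
    IsClosed (secondQuantizationCAR.range : Set (unitary carAlgebra)) := by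
  convert isClosed_range_secondQuantization.preimage
    (continuous_subtype_val.comp continuous_subtype_val :
      Continuous fun x : unitary carAlgebra => ((x : carAlgebra) : FermionFock →L[ℂ] FermionFock))
  ext x
  constructor
  · rintro ⟨u, rfl⟩; exact ⟨u, rfl⟩
  · rintro ⟨u, hu⟩; exact ⟨u, Subtype.ext (Subtype.ext hu)⟩

theorem isNUR_schattenOneUnitary : IsNUR SchattenOneUnitary := by
  let φ : SchattenOneUnitary →* unitary (FermionFock →L[ℂ] FermionFock) :=
    secondQuantizationHom.comp toUnitary
  have hφ : IsEmbedding φ :=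
    (IsEmbedding.of_comp_iff IsEmbedding.subtypeVal).1 isEmbedding_secondQuantization
  -- Continuity of the group operations of `𝒰₁` is pulled back along the inducing homomorphism `φ`.
  refine ⟨hφ.isInducing.topologicalGroup φ, inferInstance, FermionFock, inferInstance,
    inferInstance, inferInstance, φ.range, ?_, ⟨embeddingEquivRange φ hφ⟩⟩
  convert isClosed_range_secondQuantization.preimage (continuous_subtype_val :
      Continuous fun x : unitary (FermionFock →L[ℂ] FermionFock) =>
        (x : FermionFock →L[ℂ] FermionFock))
  ext x
  constructor
  · rintro ⟨u, rfl⟩; exact ⟨u, rfl⟩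
  · rintro ⟨u, hu⟩; exact ⟨u, Subtype.ext hu⟩

end Main

end CARFock

theorem theoremU1 :
    (∃ S : Subgroup (unitary CARFock.carAlgebra),
      IsClosed (S : Set (unitary CARFock.carAlgebra)) ∧
      ∃ e : CARFock.SchattenOneUnitary ≃ₜ* S, ∀ u : CARFock.SchattenOneUnitary,
        (((e u : unitary CARFock.carAlgebra) : CARFock.carAlgebra) :
            CARFock.FermionFock →L[ℂ] CARFock.FermionFock) =
          CARFock.secondQuantization (CARFock.SchattenOneUnitary.toUnitary u)) ∧
    CARFock.IsNUR CARFock.SchattenOneUnitary :=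
  ⟨⟨CARFock.secondQuantizationCAR.range, CARFock.isClosed_range_secondQuantizationCAR,
    CARFock.embeddingEquivRange _ CARFock.isEmbedding_secondQuantizationCAR, fun _ => rfl⟩,
    CARFock.isNUR_schattenOneUnitary⟩
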